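/- Let $k$ be a field, let $1\le n\le m$, let $R=k[x_{ij}\mid 1\le i\le n,\ 1\le j\le m]$ with the standard grading, and let $M=(x_{ij})$ be the generic $n\times m$ matrix, viewed as a map $F\to G$ of free $R$-modules with bases $f_1,\dots,f_m$ and $g_1,\dots,g_n$. Let $<$ be the lexicographic monomial order with $x_{11}>x_{12}>\cdots>x_{1m}>x_{21}>\cdots>x_{nm}$. Let $\Delta$ be a simplicial complex on the vertex set $[m]$ all of whose facets have exactly $n$ elements. Its determinantal facet ideal $J_\Delta\subseteq R$ is generated by the maximal minors of $M$ on the columns $\sigma$, for the facets $\sigma$ of $\Delta$; $\operatorname{in}_<(J_\Delta)$ is the ideal generated by the leading terms of all elements of $J_\Delta$. The clique complex $\Delta^{\mathrm{clique}}$ is the simplicial complex whose faces with at most $n$ elements are those of $\Delta$ and in which a set with at least $n$ elements is a face if and only if all its $n$-element subsets are faces of $\Delta$. A $1$-nonface of a simplicial complex $\Gamma$ on $[m]$ is a set $\sigma=\{\sigma_1<\dots<\sigma_\ell\}\notin\Gamma$ such that $\sigma\setminus\{\sigma_j\}\in\Gamma$ and $\sigma\setminus\{\sigma_{j+1}\}\in\Gamma$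 for some $1\le j<\ell$. For a simplicial complex $\Gamma$ on $[m]$, the generalized sparse Eagon--Northcott complex $\mathcal C^<_\bullet(\Gamma,M)$ has $\mathcal C^<_0=\bigwedge^nG\cong R$ (generated in degree $0$), and for $i\ge1$ the module $\mathcal C^<_i\subseteq D_{i-1}(G^*)\otimes\bigwedge^{n+i-1}F$ is the free module with basis the elements $g^{*(\alpha)}\otimes f_\sigma$ (of degree $n+i-1$) with $\sigma\in\Gamma$, $|\sigma|=n+i-1$, $\alpha\in\mathbb Z_{\ge0}^n$, $|\alpha|=i-1$. Its differential sends $f_\sigma\in\mathcal C^<_1$ to the leading term of the maximal minor of $M$ on the columns $\sigma$, and for $i\ge2$ and $I=\{I_1<\dots<I_{n+i-1}\}$ it is $$g^{*(\alpha)}\otimes f_I\longmapsto\sum_{a:\,\alpha_a>0}\ \sum_{p}(-1)^{p+1}x_{aI_p}\,g^{*(\alpha-\epsilon_a)}\otimes f_{I\setminus\{I_p\}},$$ where $p$ runs over $a+\alpha_1+\dots+\alpha_{a-1}\le p\le a+\alpha_1+\dots+\alpha_a$ and $\epsilon_a$ is the $a$-th unit vector. Assume that $\Delta^{\mathrm{clique}}$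 has no $1$-nonfaces of cardinality $n+1$. Then $\mathcal C^<_\bullet(\Delta^{\mathrm{clique}},M)$ is a complex, and for every minimal graded free resolution $F_\bullet$ of the ideal $\operatorname{in}_<(J_\Delta)$, with linear strand $F^{\mathrm{lin}}_\bullet$ (where $F^{\mathrm{lin}}_i$ is the summand of $F_i$ generated in degree $n+i$), the linear strand augmented by $R$, $$\cdots\to F_1^{\mathrm{lin}}\to F_0^{\mathrm{lin}}\to R,$$ with $F^{\mathrm{lin}}_0\to\operatorname{in}_<(J_\Delta)\subseteq R$ the augmentation, is isomorphic to $\mathcal C^<_\bullet(\Delta^{\mathrm{clique}},M)$ as a complex of graded $R$-modules ($F^{\mathrm{lin}}_i$ corresponding to $\mathcal C^<_{i+1}$). -/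

import Mathlib

open MvPolynomial

/-! ### Graded free modules over a standard graded polynomial ring

A finitely generated graded free module `⨁ b, R(-deg b)` over `R = k[x_t | t ∈ τ]` is given by
a finite type of basis elements and their degrees; its underlying module is `ι →₀ R`. -/

/-- `p` is homogeneous of degree `z ∈ ℤ`; in particular `p = 0` if `z < 0`. -/
def IsHomogeneousOfDegree {τ k : Type*} [CommSemiring k] (p : MvPolynomial τ k) (z : ℤ) : Prop :=
  p = 0 ∨ ∃ e : ℕ, (e : ℤ) = z ∧ p.IsHomogeneous e

/-- A sequence `⋯ → F₂ → F₁ → F₀` of finitely generated graded free modules over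
`k[x_t | t ∈ τ]` and homogeneous maps of degree `0`. -/
structure GradedFreeSequence.{w, u, v} (k : Type u) (τ : Type v) [Field k] where
  /-- the homogeneous basis of `F_i` -/
  ι : ℕ → Type w
  finite : ∀ i, Finite (ι i)
  /-- the degrees of the basis elements -/
  deg : ∀ i, ι i → ℤ
  /-- `d i : F_{i+1} → F_i` -/
  d : ∀ i, (ι (i + 1) →₀ MvPolynomial τ k) →ₗ[MvPolynomial τ k] (ι i →₀ MvPolynomial τ k)
  homogeneous : ∀ i b c,
    IsHomogeneousOfDegree (d i (Finsupp.single b 1) c) (deg (i + 1) b - deg i c)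

namespace GradedFreeSequence

variable {k τ : Type*} [Field k]

/-- The sequence is a chain complex. -/
def IsComplex (S : GradedFreeSequence k τ) : Prop :=
  ∀ i, S.d i ∘ₗ S.d (i + 1) = 0

/-- Isomorphisms of sequences (in particular of complexes) of graded modules: homogeneous
isomorphisms of degree `0` that commute with the differentials. -/
structure Iso (S : GradedFreeSequence k τ) (T : GradedFreeSequence k τ) where
  equiv : ∀ i, (S.ι i →₀ MvPolynomial τ k) ≃ₗ[MvPolynomial τ k] (T.ι i →₀ MvPolynomial τ k)
  homogeneous : ∀ i b c,
    IsHomogeneousOfDegree (equiv i (Finsupp.single b 1) c) (S.deg i b - T.deg i c)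
  comm : ∀ i x, T.d i (equiv (i + 1) x) = equiv i (S.d i x)

/-- The sequence `⋯ → S₁ → S₀ → R` obtained from `S` and a homogeneous map `ε : S₀ → R`, with
`R` (generated in degree `0`) in position `0` and `S_i` in position `i + 1`. -/
noncomputable def augment (S : GradedFreeSequence k τ)
    (ε : (S.ι 0 →₀ MvPolynomial τ k) →ₗ[MvPolynomial τ k] MvPolynomial τ k)
    (hε : ∀ b, IsHomogeneousOfDegree (ε (Finsupp.single b 1)) (S.deg 0 b)) :
    GradedFreeSequence k τ where
  ι
    | 0 => PUnit
    | i + 1 => S.ι i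
  finite
    | 0 => inferInstanceAs (Finite PUnit)
    | i + 1 => S.finite i
  deg
    | 0 => fun _ => 0
    | i + 1 => S.deg i
  d
    | 0 => Finsupp.lsingle PUnit.unit ∘ₗ ε
    | i + 1 => S.d i
  homogeneous
    | 0 => fun b c => by simpa using hε b
    | i + 1 => S.homogeneous i

/-- The degree-`t` linear strand: the summand `R(-t-i)^{β_{i,t+i}}` of `F_i` spanned by the basis
elements of degree `t + i`, with the corresponding blocks of the differentials. -/
noncomputable def linearStrand (S : GradedFreeSequence k τ) (t : ℤ) : GradedFreeSequence k τ where
  ι i := {b : S.ι i | S.deg i b = t + i}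
  finite i := haveI := S.finite i; inferInstance
  deg i b := S.deg i b
  d i := Finsupp.lsubtypeDomain {b : S.ι i | S.deg i b = t + i} ∘ₗ S.d i ∘ₗ
    Finsupp.lmapDomain (MvPolynomial τ k) (MvPolynomial τ k) Subtype.val
  homogeneous i b c := by
    have h : ∀ x : S.ι i →₀ MvPolynomial τ k,
        (Finsupp.lsubtypeDomain (R := MvPolynomial τ k) {b : S.ι i | S.deg i b = t + i} x) c
          = x c := fun _ => rfl
    simpa [Finsupp.mapDomain_single, h] using S.homogeneous i b c

end GradedFreeSequence

/-- A minimal graded free resolution `⋯ → F₁ → F₀ → I → 0` of an ideal `I` of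
`R = k[x_t | t ∈ τ]`, the augmentation `ε` being composed with the inclusion `I ⊆ R`. -/
structure MinimalGradedFreeResolution {k τ : Type*} [Field k] (I : Ideal (MvPolynomial τ k))
    extends GradedFreeSequence k τ where
  ε : (ι 0 →₀ MvPolynomial τ k) →ₗ[MvPolynomial τ k] MvPolynomial τ k
  ε_homogeneous : ∀ b, IsHomogeneousOfDegree (ε (Finsupp.single b 1)) (deg 0 b)
  range_ε : LinearMap.range ε = I
  exact_zero : LinearMap.ker ε = LinearMap.range (d 0)
  exact_succ : ∀ i, LinearMap.ker (d i) = LinearMap.range (d (i + 1))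
  /-- the matrix entries of the differentials lie in the ideal generated by the variables -/
  minimal : ∀ i b c, constantCoeff (d i (Finsupp.single b 1) c) = 0

namespace MinimalGradedFreeResolution

variable {k τ : Type*} [Field k] {I : Ideal (MvPolynomial τ k)}

/-- The composite `F_0^lin ⊆ F_0 → I ⊆ R`. -/
noncomputable def strandAugmentation (F : MinimalGradedFreeResolution I) (t : ℤ) :
    ({b : F.ι 0 | F.deg 0 b = t + (0 : ℕ)} →₀ MvPolynomial τ k) →ₗ[MvPolynomial τ k]
      MvPolynomial τ k :=
  F.ε ∘ₗ Finsupp.lmapDomain (MvPolynomial τ k) (MvPolynomial τ k) Subtype.val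

theorem strandAugmentation_homogeneous (F : MinimalGradedFreeResolution I) (t : ℤ)
    (b : {b : F.ι 0 | F.deg 0 b = t + (0 : ℕ)}) :
    IsHomogeneousOfDegree (F.strandAugmentation t (Finsupp.single b 1)) (F.deg 0 b) := by
  simpa [strandAugmentation, Finsupp.mapDomain_single] using F.ε_homogeneous b

/-- The degree-`t` linear strand of a minimal graded free resolution of an ideal `I`, augmented by
`R`: `R` in position `0` and the linear strand `F_i^lin` in position `i + 1`. -/
noncomputable def augmentedLinearStrand (F : MinimalGradedFreeResolution I) (t : ℤ) :
    GradedFreeSequence k τ :=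
  (F.linearStrand t).augment (F.strandAugmentation t) (F.strandAugmentation_homogeneous t)

end MinimalGradedFreeResolution

/-! ### Simplicial complexes on `[m]` -/

/-- `Δ` is `(n-1)`-pure: all its facets have dimension `n - 1`, i.e. `n` vertices. -/
def IsPureOfCard {m : ℕ} (Δ : PreAbstractSimplicialComplex (Fin m)) (n : ℕ) : Prop :=
  ∀ σ, Maximal (· ∈ Δ) σ → σ.card = n

/-- The clique complex of an `(n-1)`-pure simplicial complex `Δ`: a set of at least `n` vertices
is a face iff all its `n`-element subsets are faces of `Δ`; the faces with at most `n`
vertices are those of `Δ`. -/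
def cliqueComplex {m : ℕ} (Δ : PreAbstractSimplicialComplex (Fin m)) (n : ℕ) :
    PreAbstractSimplicialComplex (Fin m) where
  faces := {σ | σ.Nonempty ∧ ∀ ρ ⊆ σ, ρ.Nonempty → ρ.card ≤ n → ρ ∈ Δ}
  isRelLowerSet_faces := fun _ hσ =>
    ⟨hσ.1, fun _ hρ hne => ⟨hne, fun υ hυ => hσ.2 υ (hυ.trans hρ)⟩⟩

/-- `σ = {σ₀ < ⋯ < σ_{ℓ-1}}` is an `i`-nonface of `Δ`: it is not a face, but for some `j` all of
`σ ∖ σ_j, …, σ ∖ σ_{j+i}` are. -/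
def IsNonface {m : ℕ} (Δ : PreAbstractSimplicialComplex (Fin m)) (i : ℕ)
    (σ : Finset (Fin m)) : Prop :=
  σ ∉ Δ ∧ ∃ (j : ℕ) (hj : j + i < σ.card), ∀ (l : ℕ) (hl : l ≤ i),
    σ.erase (σ.orderEmbOfFin rfl ⟨j + l, by omega⟩) ∈ Δ

/-! ### Determinantal facet ideals -/

/-- `k[x_{ij} | 1 ≤ i ≤ n, 1 ≤ j ≤ m]`; the variables are indexed by the lexicographic product,
so that for the order `MonomialOrder.lex` one has `x₁₁ > x₁₂ > ⋯ > x₁ₘ > x₂₁ > ⋯ > xₙₘ`. -/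
abbrev GenericRing (k : Type*) [Field k] (n m : ℕ) : Type _ := MvPolynomial (Fin n ×ₗ Fin m) k

/-- The generic `n × m` matrix. -/
noncomputable def genericMatrix (k : Type*) [Field k] (n m : ℕ) :
    Matrix (Fin n) (Fin m) (GenericRing k n m) :=
  Matrix.of fun i j => X (toLex (i, j))

/-- The maximal minor of the generic matrix on the columns `σ`. -/
noncomputable def maximalMinor (k : Type*) [Field k] {n m : ℕ} (σ : Finset (Fin m))
    (h : σ.card = n) : GenericRing k n m :=
  ((genericMatrix k n m).submatrix id (σ.orderEmbOfFin h)).det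

/-- The `n`-determinantal facet ideal `J_Δ`. -/
noncomputable def determinantalFacetIdeal (k : Type*) [Field k] (n : ℕ) {m : ℕ}
    (Δ : PreAbstractSimplicialComplex (Fin m)) : Ideal (GenericRing k n m) :=
  Ideal.span {p | ∃ (σ : Finset (Fin m)) (h : σ.card = n),
    Maximal (· ∈ Δ) σ ∧ p = maximalMinor k σ h}

/-- The initial ideal with respect to the lexicographic order. -/
noncomputable def lexInitialIdeal {k : Type*} [Field k] {n m : ℕ}
    (J : Ideal (GenericRing k n m)) : Ideal (GenericRing k n m) :=
  Ideal.span (MonomialOrder.lex.leadingTerm '' (J : Set (GenericRing k n m)))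

theorem maximalMinor_isHomogeneous (k : Type*) [Field k] {n m : ℕ} (σ : Finset (Fin m))
    (h : σ.card = n) : (maximalMinor k σ h).IsHomogeneous n := by
  unfold maximalMinor
  rw [Matrix.det_apply]
  refine IsHomogeneous.sum _ _ _ fun π _ => ?_
  have hp : (∏ i, ((genericMatrix k n m).submatrix id (σ.orderEmbOfFin h)) (π i) i).IsHomogeneous
      (∑ _i : Fin n, 1) :=
    IsHomogeneous.prod _ _ _ fun i _ => by
      simpa [genericMatrix] using isHomogeneous_X k _
  rw [Finset.sum_const, Finset.card_univ, Fintype.card_fin, smul_eq_mul, mul_one] at hp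
  rcases Int.units_eq_one_or (Equiv.Perm.sign π) with hs | hs
  · simpa [hs] using hp
  · simpa [hs] using hp.neg

theorem leadingTerm_isHomogeneous {τ k : Type*} [Field k] (o : MonomialOrder τ)
    {p : MvPolynomial τ k} {e : ℕ} (hp : p.IsHomogeneous e) :
    (o.leadingTerm p).IsHomogeneous e := by
  by_cases h : p = 0
  · simpa [h] using isHomogeneous_zero τ k e
  · refine isHomogeneous_monomial _ ?_
    have := hp (o.leadingCoeff_ne_zero_iff.mpr h)
    rwa [Finsupp.degree_eq_weight_one]

/-! ### The generalized sparse Eagon–Northcott complex -/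

/-- The pairs `(a, p)` of a row `a` and a position `p` (both counted from `0`) such that
`(a, I_p)` belongs to the index set `𝓘_<(α, I)`, where `I` has `l` elements. For rows and positions
counted from `1` the condition reads: `α_a > 0`, and `p = a + j` with
`|α_{≤ a-1}| ≤ j ≤ |α_{≤ a}|`. -/
def sparsePairs {n : ℕ} (α : Fin n → ℕ) (l : ℕ) : Finset (Fin n × Fin l) :=
  Finset.univ.filter fun q =>
    0 < α q.1 ∧ (q.1 : ℕ) + ∑ b ∈ Finset.Iio q.1, α b ≤ q.2 ∧
      (q.2 : ℕ) ≤ q.1 + ∑ b ∈ Finset.Iic q.1, α b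

/-- The basis elements `g^{*(α)} ⊗ f_σ` of `C^<_{i+1}(Δ, M) ⊆ D_i(G^*) ⊗ ⋀^{n+i} F`: `σ` is a face
of `Δ` with `n + i` elements and `|α| = i`. -/
@[ext]
structure SparseIndex {m : ℕ} (Δ : PreAbstractSimplicialComplex (Fin m)) (n i : ℕ) where
  α : Fin n → ℕ
  σ : Finset (Fin m)
  mem : σ ∈ Δ
  card_eq : σ.card = n + i
  sum_eq : ∑ a, α a = i

namespace SparseIndex

variable {m n i : ℕ} {Δ : PreAbstractSimplicialComplex (Fin m)}

instance : Finite (SparseIndex Δ n i) :=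
  Finite.of_injective
    (fun b : SparseIndex Δ n i =>
      ((⟨b.α, Finset.mem_piAntidiag.mpr ⟨b.sum_eq, by simp⟩⟩, b.σ) :
        {α // α ∈ Finset.piAntidiag (Finset.univ : Finset (Fin n)) i} × Finset (Fin m)))
    (fun b c h => by
      simp only [Prod.mk.injEq, Subtype.mk.injEq] at h
      exact SparseIndex.ext h.1 h.2)

/-- The element `I_p` of `I = σ` in position `p`, counted from `0`. -/
def vertex (b : SparseIndex Δ n i) (p : Fin (n + i)) : Fin m :=
  b.σ.orderEmbOfFin b.card_eq p

theorem vertex_mem (b : SparseIndex Δ n i) (p : Fin (n + i)) : b.vertex p ∈ b.σ :=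
  Finset.orderEmbOfFin_mem _ _ _

/-- `g^{*(α - ε_a)} ⊗ f_{σ ∖ σ_p}`. -/
def face (b : SparseIndex Δ n (i + 1)) (a : Fin n) (ha : 0 < b.α a) (p : Fin (n + (i + 1))) :
    SparseIndex Δ n i where
  α := b.α - Pi.single a 1
  σ := b.σ.erase (b.vertex p)
  mem := by
    have hc : (b.σ.erase (b.vertex p)).card = n + i := by
      rw [Finset.card_erase_of_mem (b.vertex_mem p), b.card_eq]; omega
    refine (Δ.isRelLowerSet_faces b.mem).2 (Finset.erase_subset _ _) ?_
    rw [← Finset.card_pos, hc]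
    have := a.pos
    omega
  card_eq := by
    rw [Finset.card_erase_of_mem (b.vertex_mem p), b.card_eq]; omega
  sum_eq := by
    have h1 : ∀ c, (b.α - Pi.single a 1 : Fin n → ℕ) c + (Pi.single a 1 : Fin n → ℕ) c = b.α c := by
      intro c
      by_cases hc : c = a
      · subst hc
        simp
        omega
      · simp [hc]
    have h2 := b.sum_eq
    rw [← Finset.sum_congr rfl fun c _ => h1 c, Finset.sum_add_distrib] at h2
    simpa using h2

end SparseIndex

/-- The sparse Eagon–Northcott differential `C^<_{i+2}(Δ, M) → C^<_{i+1}(Δ, M)`,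
`g^{*(α)} ⊗ f_I ↦ ∑_{(a, I_p) ∈ 𝓘_<(α, I)} (-1)^{p+1} x_{a I_p} g^{*(α - ε_a)} ⊗ f_{I ∖ I_p}`.
As positions are counted from `0` here, the sign becomes `(-1)^p`. -/
noncomputable def sparseDifferential (k : Type*) [Field k] (n : ℕ) {m : ℕ}
    (Δ : PreAbstractSimplicialComplex (Fin m)) (i : ℕ) :
    (SparseIndex Δ n (i + 1) →₀ GenericRing k n m) →ₗ[GenericRing k n m]
      (SparseIndex Δ n i →₀ GenericRing k n m) :=
  Finsupp.linearCombination (GenericRing k n m) fun b : SparseIndex Δ n (i + 1) =>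
    ∑ q ∈ (sparsePairs b.α (n + (i + 1))).attach,
      Finsupp.single (b.face q.1.1 (Finset.mem_filter.mp q.2).2.1 q.1.2)
        ((-1) ^ (q.1.2 : ℕ) * X (toLex (q.1.1, b.vertex q.1.2)))

/-- The part `⋯ → C^<_2(Δ, M) → C^<_1(Δ, M)` of the generalized sparse Eagon–Northcott complex,
with `C^<_{i+1}(Δ, M)` in position `i` and generated in degree `n + i`. -/
noncomputable def sparseENTail (k : Type*) [Field k] (n : ℕ) {m : ℕ}
    (Δ : PreAbstractSimplicialComplex (Fin m)) : GradedFreeSequence k (Fin n ×ₗ Fin m) where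
  ι i := SparseIndex Δ n i
  finite _ := inferInstance
  deg i _ := n + i
  d i := sparseDifferential k n Δ i
  homogeneous i b c := by
    classical
    refine Or.inr ⟨1, by push_cast; ring, ?_⟩
    simp only [sparseDifferential, Finsupp.linearCombination_single, one_smul,
      Finsupp.finsetSum_apply]
    refine IsHomogeneous.sum _ _ _ fun q _ => ?_
    rw [Finsupp.single_apply]
    split_ifs
    · rcases neg_one_pow_eq_or (GenericRing k n m) (q.1.2 : ℕ) with h | h
      · simpa [h] using isHomogeneous_X k _
      · simpa [h] using (isHomogeneous_X k _).neg
    · exact isHomogeneous_zero _ _ _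

/-- The first differential `C^<_1(Δ, M) → ⋀^n G = R · g₁ ∧ ⋯ ∧ gₙ`, where `⋀^n G` is identified
with `R`: it sends `f_σ` to the initial term of the minor `⋀^n M (f_σ)`. (A basis element
`g^{*(α)} ⊗ f_σ` of `C^<_1(Δ, M)` has `α = 0`.) -/
noncomputable def sparseAugmentation (k : Type*) [Field k] (n : ℕ) {m : ℕ}
    (Δ : PreAbstractSimplicialComplex (Fin m)) :
    (SparseIndex Δ n 0 →₀ GenericRing k n m) →ₗ[GenericRing k n m] GenericRing k n m :=
  Finsupp.linearCombination (GenericRing k n m) fun b : SparseIndex Δ n 0 =>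
    MonomialOrder.lex.leadingTerm (maximalMinor (n := n) k b.σ b.card_eq)

theorem sparseAugmentation_homogeneous (k : Type*) [Field k] (n : ℕ) {m : ℕ}
    (Δ : PreAbstractSimplicialComplex (Fin m)) (b : SparseIndex Δ n 0) :
    IsHomogeneousOfDegree (sparseAugmentation k n Δ (Finsupp.single b 1)) (n + (0 : ℕ)) := by
  refine Or.inr ⟨n, by simp, ?_⟩
  rw [sparseAugmentation, Finsupp.linearCombination_single, one_smul]
  exact leadingTerm_isHomogeneous _ (maximalMinor_isHomogeneous k b.σ b.card_eq)

/-- The generalized sparse Eagon–Northcott complex `C^<_•(Δ, M)`. -/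
noncomputable def sparseEagonNorthcott (k : Type*) [Field k] (n : ℕ) {m : ℕ}
    (Δ : PreAbstractSimplicialComplex (Fin m)) : GradedFreeSequence k (Fin n ×ₗ Fin m) :=
  (sparseENTail k n Δ).augment (sparseAugmentation k n Δ) (sparseAugmentation_homogeneous k n Δ)

/-! A linear strand can be reconstructed from its last map. Call the elements of `k^ι ⊆ R^ι`
constants. Suppose that no nonzero constant is a cycle and that the cycles with linear entries are
exactly the boundaries of constants. Then an isomorphism with constant matrix in position `i` that
matches the images of the constants lifts to one in position `i + 1`, and it again matches the
images, since these are the linear cycles (`exists_constD_extension`). Two such sequences ending in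
`R` are therefore isomorphic as soon as their constants in position `1` have the same image in `R`
(`IsAugmentedLinearStrand.nonempty_iso`).

The strand of a minimal resolution of the initial ideal has these properties because the ideal
contains no nonzero form of degree below `n`. Minimality then puts the generators of `F_i` in
degrees at least `n + i` (`le_deg`), the strand is a subcomplex (`strandInclusion_d`), and exactness
of `F` descends to it. The constants in position `1` map onto the degree `n` part of the initial
ideal. That part is spanned by the diagonal monomials of the facets: in degree `n` an element of
`J_Δ` is a `k`-combination of minors, and the diagonal monomial of a minor occurs in no other minor
(`mem_lexInitialIdeal_and_isHomogeneous_iff`). The Eagon–Northcott side has the same image.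

For the sparse complex, a basis element becomes a set `U` of variables, and the entry at `U` of the
boundary of `y` is `∑ ± x_s y(U ∪ s)` over `s ∉ U` (`sparseDifferential_apply`). Comparing
coefficients of `x_s x_t` in a linear cycle shows two things. A nonzero coefficient of `x_s` at `U`
forces `U ∪ s` to be a cell; this is the only place where the absence of `1`-nonfaces enters. And
the coefficients at the facets of one cell agree up to sign. Such a cycle is the boundary of the
constants so defined (`exists_sparseDifferential_constVec_eq`). Monomials play the same role for the
augmentation. Finally, excluding `1`-nonfaces with `n + 1` elements from a clique complex excludes
all larger ones (`hasAdjacentProperty_cliqueComplex`). -/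

/-! ### Vectors of constants -/

/-- The inclusion `k^ι → R^ι` of the vectors with constant entries. -/
noncomputable def constVec (k τ : Type*) [Field k] (ι : Type*) :
    (ι →₀ k) →ₗ[k] (ι →₀ MvPolynomial τ k) :=
  Finsupp.mapRange.linearMap (Algebra.linearMap k (MvPolynomial τ k))

section constVec

variable {k τ : Type*} [Field k] {ι ι' ι'' : Type*}

@[simp]
theorem constVec_apply (x : ι →₀ k) (b : ι) : constVec k τ ι x b = C (x b) := rfl

@[simp]
theorem constVec_single (b : ι) (r : k) :
    constVec k τ ι (Finsupp.single b r) = Finsupp.single b (C r) :=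
  Finsupp.mapRange_single (hf := map_zero _)

/-- The `R`-linear map with the same matrix as a given `k`-linear map. -/
noncomputable def extendScalars (f : (ι →₀ k) →ₗ[k] (ι' →₀ k)) :
    (ι →₀ MvPolynomial τ k) →ₗ[MvPolynomial τ k] (ι' →₀ MvPolynomial τ k) :=
  Finsupp.linearCombination (MvPolynomial τ k) fun b => constVec k τ ι' (f (Finsupp.single b 1))

theorem extendScalars_single (f : (ι →₀ k) →ₗ[k] (ι' →₀ k)) (b : ι) :
    extendScalars f (Finsupp.single b 1) = constVec k τ ι' (f (Finsupp.single b 1)) := by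
  simp [extendScalars]

theorem single_C_eq_smul (b : ι) (r : k) :
    (Finsupp.single b (C r) : ι →₀ MvPolynomial τ k) = (C r : MvPolynomial τ k) •
      Finsupp.single b 1 := by
  simp

theorem constVec_smul (r : k) (x : ι →₀ k) :
    constVec k τ ι (r • x) = (C r : MvPolynomial τ k) • constVec k τ ι x := by
  ext1 b
  simp [smul_eq_C_mul]

theorem extendScalars_constVec (f : (ι →₀ k) →ₗ[k] (ι' →₀ k)) (x : ι →₀ k) :
    extendScalars f (constVec k τ ι x) = constVec k τ ι' (f x) := by
  induction x using Finsupp.induction_linear with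
  | zero => simp
  | add x y hx hy => simp only [map_add, hx, hy]
  | single b r =>
    rw [constVec_single, single_C_eq_smul, map_smul, extendScalars_single, ← constVec_smul,
      ← map_smul, Finsupp.smul_single_one]

theorem extendScalars_extendScalars (g : (ι' →₀ k) →ₗ[k] (ι'' →₀ k))
    (f : (ι →₀ k) →ₗ[k] (ι' →₀ k)) (x : ι →₀ MvPolynomial τ k) :
    extendScalars g (extendScalars f x) = extendScalars (g ∘ₗ f) x := by
  have : (extendScalars g ∘ₗ extendScalars f :
      (ι →₀ MvPolynomial τ k) →ₗ[MvPolynomial τ k] _) = extendScalars (g ∘ₗ f) := by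
    refine Finsupp.lhom_ext' fun b => LinearMap.ext_ring ?_
    simp [extendScalars_single, extendScalars_constVec]
  exact LinearMap.congr_fun this x

theorem extendScalars_id (x : ι →₀ MvPolynomial τ k) :
    extendScalars (LinearMap.id : (ι →₀ k) →ₗ[k] (ι →₀ k)) x = x := by
  have : (extendScalars (LinearMap.id : (ι →₀ k) →ₗ[k] (ι →₀ k)) :
      (ι →₀ MvPolynomial τ k) →ₗ[MvPolynomial τ k] _) = LinearMap.id := by
    refine Finsupp.lhom_ext' fun b => LinearMap.ext_ring ?_
    simp [extendScalars_single]
  exact LinearMap.congr_fun this x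

/-- The `R`-linear equivalence with the same matrix as a given `k`-linear equivalence. -/
noncomputable def extendScalarsEquiv (τ : Type*) (e : (ι →₀ k) ≃ₗ[k] (ι' →₀ k)) :
    (ι →₀ MvPolynomial τ k) ≃ₗ[MvPolynomial τ k] (ι' →₀ MvPolynomial τ k) :=
  LinearEquiv.ofLinearMap (extendScalars e.toLinearMap) (extendScalars e.symm.toLinearMap)
    (LinearMap.ext fun x => by simp [extendScalars_extendScalars, extendScalars_id])
    (LinearMap.ext fun x => by simp [extendScalars_extendScalars, extendScalars_id])

theorem extendScalarsEquiv_constVec (e : (ι →₀ k) ≃ₗ[k] (ι' →₀ k)) (x : ι →₀ k) :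
    extendScalarsEquiv τ e (constVec k τ ι x) = constVec k τ ι' (e x) :=
  extendScalars_constVec _ x

theorem extendScalarsEquiv_symm (e : (ι →₀ k) ≃ₗ[k] (ι' →₀ k)) :
    (extendScalarsEquiv τ e).symm = extendScalarsEquiv τ e.symm := rfl

theorem isHomogeneous_extendScalarsEquiv (e : (ι →₀ k) ≃ₗ[k] (ι' →₀ k))
    {y : ι →₀ MvPolynomial τ k} {d : ℕ} (hy : ∀ b, (y b).IsHomogeneous d) (c : ι') :
    (extendScalarsEquiv τ e y c).IsHomogeneous d := by
  change (extendScalars e.toLinearMap y c).IsHomogeneous d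
  rw [extendScalars, Finsupp.linearCombination_apply, Finsupp.sum, Finsupp.finsetSum_apply]
  refine IsHomogeneous.sum _ _ _ fun b _ => ?_
  have h := (hy b).mul (isHomogeneous_C τ (e (Finsupp.single b 1) c))
  rwa [add_zero] at h

/-- The two copies of `PUnit` may live in different universes, so even the identity of `R` in
position `0` has to be given by relabelling a basis. -/
theorem extendScalarsEquiv_punit (y : PUnit →₀ MvPolynomial τ k) :
    extendScalarsEquiv τ (Finsupp.domLCongr (M := k) (R := k) Equiv.punitEquivPUnit) y PUnit.unit =
      y PUnit.unit := by
  have hy : y = y PUnit.unit • constVec k τ PUnit (Finsupp.single PUnit.unit 1) := by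
    ext
    simp
  conv_lhs => rw [hy]
  rw [map_smul (extendScalarsEquiv τ _), extendScalarsEquiv_constVec, Finsupp.domLCongr_single]
  simp

/-- An injective `k`-linear map on constants is determined up to isomorphism by its range. -/
theorem exists_equiv_of_range_eq {V : Type*} [AddCommGroup V] [Module k V]
    {f : (ι →₀ k) →ₗ[k] V} {g : (ι' →₀ k) →ₗ[k] V}
    (hf : Function.Injective f) (hg : Function.Injective g)
    (h : LinearMap.range f = LinearMap.range g) :
    ∃ e : (ι →₀ k) ≃ₗ[k] (ι' →₀ k), ∀ x, g (e x) = f x := by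
  refine ⟨(LinearEquiv.ofInjective f hf).trans
    ((LinearEquiv.ofEq _ _ h).trans (LinearEquiv.ofInjective g hg).symm), fun x => ?_⟩
  simp

end constVec

/-! ### Uniqueness of linear strands -/

namespace GradedFreeSequence

variable {k τ : Type*} [Field k]

/-- The differentials are given by matrices of linear forms, except possibly the last one, no
nonzero vector of constants is a cycle, and the cycles with linear entries are precisely the
boundaries of the vectors of constants. Such a sequence is determined by the image
of the vectors of constants under the last differential. -/
structure IsLinearStrand (A : GradedFreeSequence k τ) : Prop where
  injective : ∀ i x, A.d i (constVec k τ _ x) = 0 → x = 0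
  linear : ∀ i x b, (A.d (i + 1) (constVec k τ _ x) b).IsHomogeneous 1
  comp : ∀ i x, A.d i (A.d (i + 1) x) = 0
  exact : ∀ i y, (∀ b, (y b).IsHomogeneous 1) → A.d i y = 0 →
    ∃ x, A.d (i + 1) (constVec k τ _ x) = y

/-- The differential on the vectors of constants. -/
noncomputable def constD (A : GradedFreeSequence k τ) (i : ℕ) :
    (A.ι (i + 1) →₀ k) →ₗ[k] (A.ι i →₀ MvPolynomial τ k) :=
  (A.d i).restrictScalars k ∘ₗ constVec k τ _

theorem constD_apply (A : GradedFreeSequence k τ) (i : ℕ) (x : A.ι (i + 1) →₀ k) :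
    A.constD i x = A.d i (constVec k τ _ x) := rfl

/-- Since `e` matches the injective images of the constants, it induces `e'` on the constants
themselves. The images one position higher are the spaces of linear cycles, which `e'` matches
because the square commutes and a constant matrix preserves linearity of the entries. -/
theorem exists_constD_extension (A B : GradedFreeSequence k τ) (hA : A.IsLinearStrand)
    (hB : B.IsLinearStrand) (i : ℕ) (e : (A.ι i →₀ k) ≃ₗ[k] (B.ι i →₀ k))
    (he : ∀ y, y ∈ LinearMap.range (A.constD i) ↔
      extendScalarsEquiv τ e y ∈ LinearMap.range (B.constD i)) :
    ∃ e' : (A.ι (i + 1) →₀ k) ≃ₗ[k] (B.ι (i + 1) →₀ k),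
      (∀ y, y ∈ LinearMap.range (A.constD (i + 1)) ↔
        extendScalarsEquiv τ e' y ∈ LinearMap.range (B.constD (i + 1))) ∧
      ∀ x, B.d i (extendScalarsEquiv τ e' x) = extendScalarsEquiv τ e (A.d i x) := by
  have injA : Function.Injective (A.constD i) :=
    (injective_iff_map_eq_zero _).mpr fun x hx => hA.injective i x hx
  have injB : Function.Injective (B.constD i) :=
    (injective_iff_map_eq_zero _).mpr fun x hx => hB.injective i x hx
  obtain ⟨e', he'⟩ := exists_equiv_of_range_eq
    (f := ((extendScalarsEquiv τ e).toLinearMap.restrictScalars k) ∘ₗ A.constD i)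
    (g := B.constD i) ((extendScalarsEquiv τ e).injective.comp injA) injB (by
      ext z
      constructor
      · rintro ⟨x, rfl⟩
        exact (he _).mp ⟨x, rfl⟩
      · intro hz
        have h1 := (he ((extendScalarsEquiv τ e).symm z)).mpr (by simpa using hz)
        obtain ⟨x, hx⟩ := h1
        refine ⟨x, ?_⟩
        change extendScalarsEquiv τ e (A.constD i x) = z
        rw [hx]
        simp)
  have hcomm : ∀ x, B.d i (extendScalarsEquiv τ e' x) = extendScalarsEquiv τ e (A.d i x) := by
    intro x
    have : B.d i ∘ₗ (extendScalarsEquiv τ e').toLinearMap =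
        (extendScalarsEquiv τ e).toLinearMap ∘ₗ A.d i := by
      refine Finsupp.lhom_ext' fun b => LinearMap.ext_ring ?_
      have h := he' (Finsupp.single b 1)
      rw [constD_apply, ← extendScalarsEquiv_constVec] at h
      simpa [constD_apply] using h
    exact LinearMap.congr_fun this x
  refine ⟨e', fun y => ⟨?_, ?_⟩, hcomm⟩
  · rintro ⟨x, rfl⟩
    obtain ⟨z, hz⟩ := hB.exact i (extendScalarsEquiv τ e' (A.constD (i + 1) x))
      (isHomogeneous_extendScalarsEquiv e' (hA.linear i x))
      (by rw [hcomm, constD_apply, hA.comp, map_zero])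
    exact ⟨z, hz⟩
  · rintro ⟨x, hx⟩
    have hy : y = extendScalarsEquiv τ e'.symm (B.constD (i + 1) x) := by
      rw [hx, ← extendScalarsEquiv_symm, LinearEquiv.symm_apply_apply]
    obtain ⟨z, hz⟩ := hA.exact i y
      (fun b => hy ▸ isHomogeneous_extendScalarsEquiv e'.symm (hB.linear i x) b)
      ((extendScalarsEquiv τ e).injective (by
        rw [← hcomm, ← hx, constD_apply, hB.comp, map_zero]))
    exact ⟨z, hz⟩

theorem IsLinearStrand.nonempty_iso {A B : GradedFreeSequence k τ} (hA : A.IsLinearStrand)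
    (hB : B.IsLinearStrand) (hdeg : ∀ i b c, A.deg i b = B.deg i c)
    (e : (A.ι 0 →₀ k) ≃ₗ[k] (B.ι 0 →₀ k))
    (he : ∀ y, y ∈ LinearMap.range (A.constD 0) ↔
      extendScalarsEquiv τ e y ∈ LinearMap.range (B.constD 0)) :
    Nonempty (A.Iso B) := by
  -- The matching of images is carried along with the equivalence, because the next step of the
  -- recursion needs it.
  let P : ℕ → Type _ := fun i => {e : (A.ι i →₀ k) ≃ₗ[k] (B.ι i →₀ k) //
    ∀ y, y ∈ LinearMap.range (A.constD i) ↔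
      extendScalarsEquiv τ e y ∈ LinearMap.range (B.constD i)}
  have step : ∀ i (x : P i), ∃ y : P (i + 1), ∀ z,
      B.d i (extendScalarsEquiv τ y.1 z) = extendScalarsEquiv τ x.1 (A.d i z) := by
    intro i x
    obtain ⟨e', h1, h2⟩ := exists_constD_extension A B hA hB i x.1 x.2
    exact ⟨⟨e', h1⟩, h2⟩
  choose f hf using step
  let s : ∀ i, P i := fun i => Nat.rec ⟨e, he⟩ f i
  exact ⟨{
    equiv := fun i => extendScalarsEquiv τ (s i).1
    homogeneous := fun i b c => by
      refine Or.inr ⟨0, by simp [hdeg i b c], ?_⟩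
      change (extendScalars _ (Finsupp.single b 1) c).IsHomogeneous 0
      rw [extendScalars_single, constVec_apply]
      exact isHomogeneous_C _ _
    comm := fun i x => hf i (s i) x }⟩

/-- The conditions on `⋯ → S₁ → S₀ → R` that make `S.augment ε` a linear strand. -/
structure IsAugmentedLinearStrand (S : GradedFreeSequence k τ)
    (ε : (S.ι 0 →₀ MvPolynomial τ k) →ₗ[MvPolynomial τ k] MvPolynomial τ k) : Prop where
  ε_injective : ∀ x, ε (constVec k τ _ x) = 0 → x = 0
  d_injective : ∀ i x, S.d i (constVec k τ _ x) = 0 → x = 0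
  linear : ∀ i x b, (S.d i (constVec k τ _ x) b).IsHomogeneous 1
  ε_comp : ∀ x, ε (S.d 0 x) = 0
  d_comp : ∀ i x, S.d i (S.d (i + 1) x) = 0
  exact_zero : ∀ y, (∀ b, (y b).IsHomogeneous 1) → ε y = 0 → ∃ x, S.d 0 (constVec k τ _ x) = y
  exact_succ : ∀ i y, (∀ b, (y b).IsHomogeneous 1) → S.d i y = 0 →
    ∃ x, S.d (i + 1) (constVec k τ _ x) = y

theorem augment_d_zero_eq_zero_iff (S : GradedFreeSequence k τ)
    (ε : (S.ι 0 →₀ MvPolynomial τ k) →ₗ[MvPolynomial τ k] MvPolynomial τ k)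
    (hε : ∀ b, IsHomogeneousOfDegree (ε (Finsupp.single b 1)) (S.deg 0 b))
    (x : S.ι 0 →₀ MvPolynomial τ k) : (S.augment ε hε).d 0 x = 0 ↔ ε x = 0 :=
  Finsupp.single_eq_zero

theorem IsAugmentedLinearStrand.augment {S : GradedFreeSequence k τ}
    {ε : (S.ι 0 →₀ MvPolynomial τ k) →ₗ[MvPolynomial τ k] MvPolynomial τ k}
    (h : S.IsAugmentedLinearStrand ε)
    (hε : ∀ b, IsHomogeneousOfDegree (ε (Finsupp.single b 1)) (S.deg 0 b)) :
    (S.augment ε hε).IsLinearStrand where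
  injective
    | 0 => fun x hx => h.ε_injective x ((augment_d_zero_eq_zero_iff S ε hε _).mp hx)
    | i + 1 => h.d_injective i
  linear := h.linear
  comp
    | 0 => fun x => (augment_d_zero_eq_zero_iff S ε hε _).mpr (h.ε_comp x)
    | i + 1 => h.d_comp i
  exact
    | 0 => fun y hy hd => h.exact_zero y hy ((augment_d_zero_eq_zero_iff S ε hε _).mp hd)
    | i + 1 => h.exact_succ i

theorem mem_range_constD_augment_iff (S : GradedFreeSequence k τ)
    (ε : (S.ι 0 →₀ MvPolynomial τ k) →ₗ[MvPolynomial τ k] MvPolynomial τ k)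
    (hε : ∀ b, IsHomogeneousOfDegree (ε (Finsupp.single b 1)) (S.deg 0 b))
    (y : PUnit →₀ MvPolynomial τ k) :
    y ∈ LinearMap.range ((S.augment ε hε).constD 0) ↔
      ∃ x, ε (constVec k τ _ x) = y PUnit.unit := by
  refine exists_congr fun x => ?_
  have h : y = Finsupp.single PUnit.unit (y PUnit.unit) := (Finsupp.unique_single y)
  constructor
  · rintro rfl
    exact Finsupp.single_eq_same.symm
  · intro hx
    exact (congrArg (Finsupp.single PUnit.unit) hx).trans h.symm

theorem IsAugmentedLinearStrand.nonempty_iso {S T : GradedFreeSequence k τ}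
    {ε : (S.ι 0 →₀ MvPolynomial τ k) →ₗ[MvPolynomial τ k] MvPolynomial τ k}
    {η : (T.ι 0 →₀ MvPolynomial τ k) →ₗ[MvPolynomial τ k] MvPolynomial τ k}
    (hS : S.IsAugmentedLinearStrand ε) (hT : T.IsAugmentedLinearStrand η)
    (hε : ∀ b, IsHomogeneousOfDegree (ε (Finsupp.single b 1)) (S.deg 0 b))
    (hη : ∀ b, IsHomogeneousOfDegree (η (Finsupp.single b 1)) (T.deg 0 b))
    (hdeg : ∀ i b c, S.deg i b = T.deg i c)
    (h : ∀ p, (∃ x, ε (constVec k τ _ x) = p) ↔ ∃ x, η (constVec k τ _ x) = p) :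
    Nonempty ((S.augment ε hε).Iso (T.augment η hη)) := by
  let e : (PUnit →₀ k) ≃ₗ[k] (PUnit →₀ k) := Finsupp.domLCongr Equiv.punitEquivPUnit
  refine (hS.augment hε).nonempty_iso (hT.augment hη) ?_ e ?_
  · rintro (_ | i) b c
    · rfl
    · exact hdeg i b c
  · intro y
    refine (mem_range_constD_augment_iff S ε hε y).trans ((h _).trans ?_)
    refine Iff.trans ?_ (mem_range_constD_augment_iff T η hη (extendScalarsEquiv τ e y)).symm
    exact iff_of_eq (congrArg (fun p => ∃ x, η (constVec k τ _ x) = p)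
      (extendScalarsEquiv_punit y).symm)

end GradedFreeSequence

/-! ### Lowest-degree parts of linear maps -/

/-- A component of `w` of positive degree moves `h` above degree `e ≥ d`, so only the constant term
of `w` can contribute. -/
theorem homogeneousComponent_mul_of_isHomogeneous {k τ : Type*} [Field k] (w : MvPolynomial τ k)
    {h : MvPolynomial τ k} {e d : ℕ} (hh : h.IsHomogeneous e) (hde : d ≤ e) :
    homogeneousComponent d (w * h) = if e = d then C (coeff 0 w) * h else 0 := by
  conv_lhs => rw [← sum_homogeneousComponent w, Finset.sum_mul, map_sum]
  rw [Finset.sum_eq_single_of_mem 0 (by simp)]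
  · rw [homogeneousComponent_of_mem ((homogeneousComponent_isHomogeneous 0 w).mul hh),
      homogeneousComponent_zero, zero_add]
    simp [eq_comm]
  · intro j _ hj
    rw [homogeneousComponent_of_mem ((homogeneousComponent_isHomogeneous j w).mul hh)]
    exact if_neg (by omega)

theorem isHomogeneous_zero_degree {k τ : Type*} [Field k] {p : MvPolynomial τ k}
    (h : p.IsHomogeneous 0) : p = C (constantCoeff p) :=
  totalDegree_eq_zero_iff_eq_C.mp (Nat.le_zero.mp h.totalDegree_le)

section

variable {k τ : Type*} [Field k] {ι : Type*}

theorem linearMap_eq_sum [Fintype ι] {M : Type*} [AddCommMonoid M] [Module (MvPolynomial τ k) M]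
    (f : (ι →₀ MvPolynomial τ k) →ₗ[MvPolynomial τ k] M) (w : ι →₀ MvPolynomial τ k) :
    f w = ∑ b, w b • f (Finsupp.single b 1) := by
  conv_lhs => rw [← Finsupp.univ_sum_single w, map_sum]
  refine Finset.sum_congr rfl fun b _ => ?_
  rw [← map_smul, Finsupp.smul_single, smul_eq_mul, mul_one]

/-- The constant terms of the entries of `w` at the basis elements of degree `D`. -/
noncomputable def constPart (deg : ι → ℤ) (D : ℤ) (w : ι →₀ MvPolynomial τ k) :
    {b : ι | deg b = D} →₀ k :=
  (w.mapRange (coeff 0) (coeff_zero 0)).subtypeDomain (· ∈ {b : ι | deg b = D})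

/-- If every basis element has degree at least `D`, a value of the lowest possible degree sees only
the constant terms of `w` at the basis elements of degree exactly `D`. This replaces arbitrary
preimages by constant ones. -/
theorem map_constPart [Finite ι] (deg : ι → ℤ) {D t : ℤ}
    (f : (ι →₀ MvPolynomial τ k) →ₗ[MvPolynomial τ k] MvPolynomial τ k)
    (hf : ∀ b, IsHomogeneousOfDegree (f (Finsupp.single b 1)) (deg b - t))
    (hD : ∀ b, D ≤ deg b) {d : ℕ} (hd : (d : ℤ) = D - t) (w : ι →₀ MvPolynomial τ k)
    (hw : (f w).IsHomogeneous d) :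
    f ((constVec k τ _ (constPart deg D w)).mapDomain Subtype.val) = f w := by
  have := Fintype.ofFinite ι
  rw [← homogeneousComponent_of_mem hw |>.trans (if_pos rfl), linearMap_eq_sum f w,
    linearMap_eq_sum f, map_sum]
  refine Finset.sum_congr rfl fun b _ => ?_
  rw [smul_eq_mul, smul_eq_mul]
  by_cases hb : deg b = D
  · have h1 : (constVec k τ _ (constPart deg D w)).mapDomain Subtype.val b = C (coeff 0 (w b)) :=
      Finsupp.mapDomain_apply Subtype.val_injective _ (⟨b, hb⟩ : {b : ι | deg b = D})
    rw [h1]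
    rcases hf b with h0 | ⟨e, he, h⟩
    · simp [h0]
    · rw [homogeneousComponent_mul_of_isHomogeneous _ h (by omega), if_pos (by omega)]
  · have h1 : (constVec k τ _ (constPart deg D w)).mapDomain Subtype.val b = 0 :=
      Finsupp.mapDomain_of_notMem_range _ _ (by simpa using hb)
    have := hD b
    rw [h1, zero_mul]
    rcases hf b with h0 | ⟨e, he, h⟩
    · simp [h0]
    · rw [homogeneousComponent_mul_of_isHomogeneous _ h (by omega), if_neg (by omega)]

end

/-! ### The linear strand of a minimal resolution -/

namespace MinimalGradedFreeResolution

variable {k τ : Type*} [Field k] {I : Ideal (MvPolynomial τ k)}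
  (F : MinimalGradedFreeResolution I)

theorem constantCoeff_d (i : ℕ) (w : F.ι (i + 1) →₀ MvPolynomial τ k) (c : F.ι i) :
    constantCoeff (F.d i w c) = 0 := by
  have := F.finite (i + 1)
  have := Fintype.ofFinite (F.ι (i + 1))
  rw [linearMap_eq_sum, Finsupp.finsetSum_apply, map_sum]
  refine Finset.sum_eq_zero fun b _ => ?_
  simp [F.minimal]

/-- By minimality the entries of a boundary have no constant terms. Together with exactness this
rules out nonzero constant cycles. -/
theorem constVec_eq_zero_of_mem_range {i : ℕ} {x : F.ι i →₀ k}
    (h : constVec k τ _ x ∈ LinearMap.range (F.d i)) : x = 0 := by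
  obtain ⟨w, hw⟩ := h
  ext c
  have := F.constantCoeff_d i w c
  rw [hw] at this
  simpa using this

theorem ε_single_ne_zero (b : F.ι 0) : F.ε (Finsupp.single b 1) ≠ 0 := by
  intro h
  have h1 : constVec k τ _ (Finsupp.single b (1 : k)) ∈ LinearMap.range (F.d 0) := by
    rw [← F.exact_zero]
    simpa using h
  simpa using F.constVec_eq_zero_of_mem_range h1

theorem d_single_ne_zero (i : ℕ) (b : F.ι (i + 1)) : F.d i (Finsupp.single b 1) ≠ 0 := by
  intro h
  have h1 : constVec k τ _ (Finsupp.single b (1 : k)) ∈ LinearMap.range (F.d (i + 1)) := by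
    rw [← F.exact_succ]
    simpa using h
  simpa using F.constVec_eq_zero_of_mem_range h1

variable {n : ℕ} (hI : ∀ p ∈ I, p ≠ 0 → ∀ e, p.IsHomogeneous e → n ≤ e)

-- A basis element has a nonzero boundary, whose nonzero entries have positive degree by minimality.
-- Hence the least degree grows by at least one in each step, starting from the bound `n` for the
-- ideal.
include hI in
theorem le_deg (i : ℕ) (b : F.ι i) : (n : ℤ) + i ≤ F.deg i b := by
  induction i with
  | zero =>
    rcases F.ε_homogeneous b with h | ⟨e, he, h⟩
    · exact absurd h (F.ε_single_ne_zero b)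
    · have := hI _ (F.range_ε.le ⟨_, rfl⟩) (F.ε_single_ne_zero b) e h
      push_cast
      omega
  | succ i ih =>
    obtain ⟨c, hc⟩ := Finsupp.ne_iff.mp (F.d_single_ne_zero i b)
    rcases F.homogeneous i b c with h | ⟨e, he, h⟩
    · exact absurd h hc
    · have h0 : e ≠ 0 := by
        rintro rfl
        exact hc ((isHomogeneous_zero_degree h).trans (by rw [F.minimal, map_zero]; rfl))
      have := ih c
      push_cast
      omega

/-- The inclusion of the basis of the linear strand. -/
def strandVal (t : ℤ) (i : ℕ) : (F.linearStrand t).ι i → F.ι i := Subtype.val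

theorem strandVal_injective (t : ℤ) (i : ℕ) : Function.Injective (F.strandVal t i) :=
  Subtype.val_injective

/-- The inclusion of the linear strand. -/
noncomputable def strandInclusion (t : ℤ) (i : ℕ) :
    ((F.linearStrand t).ι i →₀ MvPolynomial τ k) →ₗ[MvPolynomial τ k]
      (F.ι i →₀ MvPolynomial τ k) :=
  Finsupp.lmapDomain (MvPolynomial τ k) (MvPolynomial τ k) (F.strandVal t i)

theorem strandInclusion_apply (t : ℤ) (i : ℕ) (x : (F.linearStrand t).ι i →₀ MvPolynomial τ k)
    (b : (F.linearStrand t).ι i) : F.strandInclusion t i x (F.strandVal t i b) = x b :=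
  Finsupp.mapDomain_apply (F.strandVal_injective t i) _ _

theorem strandInclusion_injective (t : ℤ) (i : ℕ) :
    Function.Injective (F.strandInclusion t i) :=
  Finsupp.mapDomain_injective (F.strandVal_injective t i)

theorem linearStrand_d_apply (t : ℤ) (i : ℕ)
    (x : (F.linearStrand t).ι (i + 1) →₀ MvPolynomial τ k) (c : (F.linearStrand t).ι i) :
    (F.linearStrand t).d i x c = F.d i (F.strandInclusion t (i + 1) x) (F.strandVal t i c) := rfl

theorem strandInclusion_constVec (t : ℤ) (i : ℕ) (x : (F.linearStrand t).ι i →₀ k) :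
    F.strandInclusion t i (constVec k τ _ x) = constVec k τ _ (x.mapDomain (F.strandVal t i)) := by
  induction x using Finsupp.induction_linear with
  | zero => simp [Finsupp.mapDomain_zero]
  | add x y hx hy => rw [map_add, map_add, hx, hy, Finsupp.mapDomain_add, map_add]
  | single b r => simp [strandInclusion, Finsupp.mapDomain_single]

-- The strand is a subcomplex: an entry leading from degree `n + i + 1` to a basis element of degree
-- above `n + i` could only be a constant, and minimality makes it zero.
include hI in
theorem strandInclusion_d (i : ℕ) (x : (F.linearStrand n).ι (i + 1) →₀ MvPolynomial τ k) :
    F.strandInclusion n i ((F.linearStrand n).d i x) = F.d i (F.strandInclusion n (i + 1) x) := by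
  have := (F.linearStrand n).finite (i + 1)
  have := Fintype.ofFinite ((F.linearStrand n).ι (i + 1))
  ext1 c
  by_cases hc : F.deg i c = n + i
  · exact F.strandInclusion_apply n i _ ⟨c, hc⟩
  · rw [strandInclusion, Finsupp.lmapDomain_apply,
      Finsupp.mapDomain_of_notMem_range _ _ (by rintro ⟨b, rfl⟩; exact hc b.2),
      ← LinearMap.comp_apply, linearMap_eq_sum, Finsupp.finsetSum_apply, eq_comm]
    refine Finset.sum_eq_zero fun b _ => ?_
    have hb : F.deg (i + 1) (F.strandVal n (i + 1) b) = n + (i + 1 : ℕ) := b.2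
    have hcn := F.le_deg hI i c
    have h0 : F.d i (Finsupp.single (F.strandVal n (i + 1) b) 1) c = 0 := by
      rcases F.homogeneous i (F.strandVal n (i + 1) b) c with h | ⟨e, he, h⟩
      · exact h
      · obtain rfl : e = 0 := by push_cast at hb; omega
        exact (isHomogeneous_zero_degree h).trans (by rw [F.minimal, map_zero])
    simp [strandInclusion, Finsupp.mapDomain_single, h0]

theorem d_d (i : ℕ) (x : F.ι (i + 1 + 1) →₀ MvPolynomial τ k) : F.d i (F.d (i + 1) x) = 0 :=
  (F.exact_succ i).ge ⟨x, rfl⟩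

theorem ε_d (x : F.ι 1 →₀ MvPolynomial τ k) : F.ε (F.d 0 x) = 0 :=
  F.exact_zero.ge ⟨x, rfl⟩

theorem isHomogeneous_linearStrand_d (t : ℤ) (i : ℕ) (x : (F.linearStrand t).ι (i + 1) →₀ k)
    (b : (F.linearStrand t).ι i) :
    ((F.linearStrand t).d i (constVec k τ _ x) b).IsHomogeneous 1 := by
  have := (F.linearStrand t).finite (i + 1)
  have := Fintype.ofFinite ((F.linearStrand t).ι (i + 1))
  rw [linearMap_eq_sum, Finsupp.finsetSum_apply]
  refine IsHomogeneous.sum _ _ _ fun c _ => ?_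
  have h1 : (F.linearStrand t).deg (i + 1) c = t + (i + 1 : ℕ) := c.2
  have h2 : (F.linearStrand t).deg i b = t + i := b.2
  rw [Finsupp.smul_apply, smul_eq_mul, constVec_apply]
  rcases (F.linearStrand t).homogeneous i c b with h | ⟨e, he, h⟩
  · rw [h, mul_zero]
    exact isHomogeneous_zero _ _ _
  · obtain rfl : e = 1 := by push_cast at h1; omega
    simpa using (isHomogeneous_C τ (x c)).mul h

-- A preimage in `F` may be cut down to its constant terms at basis elements of degree `n + i + 1`,
-- because the prescribed entries are linear and sit at basis elements of degree `n + i`.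
include hI in
theorem exists_linearStrand_d_eq (i : ℕ) (y : (F.linearStrand n).ι i →₀ MvPolynomial τ k)
    (hy : ∀ b, (y b).IsHomogeneous 1)
    (h : F.strandInclusion n i y ∈ LinearMap.range (F.d i)) :
    ∃ x, (F.linearStrand n).d i (constVec k τ _ x) = y := by
  have := F.finite (i + 1)
  obtain ⟨w, hw⟩ := h
  refine ⟨constPart (F.deg (i + 1)) (n + (i + 1 : ℕ)) w, ?_⟩
  ext1 c
  have hc : F.deg i (F.strandVal n i c) = n + i := c.2
  have hwc : F.d i w (F.strandVal n i c) = y c := by rw [hw, strandInclusion_apply]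
  rw [linearStrand_d_apply, ← hwc]
  refine map_constPart (F.deg (i + 1)) (t := F.deg i (F.strandVal n i c)) (d := 1)
    (Finsupp.lapply (F.strandVal n i c) ∘ₗ F.d i) (fun b => F.homogeneous i b _) (F.le_deg hI (i + 1))
    (by push_cast; omega) w ?_
  simpa [hwc] using hy c

include hI in
theorem exists_strandAugmentation_eq_iff (p : MvPolynomial τ k) :
    (∃ x, F.strandAugmentation n (constVec k τ _ x) = p) ↔ p ∈ I ∧ p.IsHomogeneous n := by
  have := F.finite 0
  constructor
  · rintro ⟨x, rfl⟩
    refine ⟨F.range_ε.le ⟨_, rfl⟩, ?_⟩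
    have := Fintype.ofFinite {b : F.ι 0 | F.deg 0 b = n + (0 : ℕ)}
    rw [linearMap_eq_sum]
    refine IsHomogeneous.sum _ _ _ fun c _ => ?_
    have h1 : F.deg 0 c.1 = n + (0 : ℕ) := c.2
    rw [smul_eq_mul, constVec_apply]
    rcases F.strandAugmentation_homogeneous n c with h | ⟨e, he, h⟩
    · rw [h, mul_zero]
      exact isHomogeneous_zero _ _ _
    · obtain rfl : e = n := by push_cast at h1; omega
      have h3 := (isHomogeneous_C τ (x c)).mul h
      rwa [zero_add] at h3
  · rintro ⟨h1, h2⟩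
    obtain ⟨w, hw⟩ := F.range_ε.ge h1
    refine ⟨constPart (F.deg 0) (n + (0 : ℕ)) w, Eq.trans ?_ hw⟩
    exact map_constPart (F.deg 0) (t := 0) (d := n) F.ε
      (fun b => by simpa using F.ε_homogeneous b) (F.le_deg hI 0) (by simp) w (hw ▸ h2)

theorem eq_zero_of_strandInclusion_mem_range {t : ℤ} {i : ℕ} {x : (F.linearStrand t).ι i →₀ k}
    (h : F.strandInclusion t i (constVec k τ _ x) ∈ LinearMap.range (F.d i)) : x = 0 := by
  rw [strandInclusion_constVec] at h
  refine Finsupp.mapDomain_injective (F.strandVal_injective t i) ?_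
  rw [F.constVec_eq_zero_of_mem_range h, Finsupp.mapDomain_zero]

include hI in
theorem isAugmentedLinearStrand_linearStrand :
    (F.linearStrand n).IsAugmentedLinearStrand (F.strandAugmentation n) where
  ε_injective x hx := F.eq_zero_of_strandInclusion_mem_range (F.exact_zero.le hx)
  d_injective i x hx := by
    refine F.eq_zero_of_strandInclusion_mem_range ((F.exact_succ i).le ?_)
    rw [LinearMap.mem_ker, ← F.strandInclusion_d hI, hx, map_zero]
  linear := F.isHomogeneous_linearStrand_d n
  ε_comp x := (congrArg F.ε (F.strandInclusion_d hI 0 x)).trans (F.ε_d _)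
  d_comp i x := by
    refine F.strandInclusion_injective n i ?_
    rw [F.strandInclusion_d hI, F.strandInclusion_d hI, F.d_d, map_zero]
  exact_zero y hy h := F.exists_linearStrand_d_eq hI 0 y hy (F.exact_zero.le h)
  exact_succ i y hy h := by
    refine F.exists_linearStrand_d_eq hI (i + 1) y hy ((F.exact_succ i).le ?_)
    rw [LinearMap.mem_ker, ← F.strandInclusion_d hI, h, map_zero]

end MinimalGradedFreeResolution

/-! ### Leading terms of maximal minors -/

section Minors

variable {n m : ℕ}

/-- The exponent of the term of a minor that belongs to the permutation `π`. -/
noncomputable def permExponent (c : Fin n → Fin m) (π : Equiv.Perm (Fin n)) :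
    (Fin n ×ₗ Fin m) →₀ ℕ :=
  ∑ i, Finsupp.single (toLex (π i, c i)) 1

theorem permExponent_apply (c : Fin n → Fin m) (π : Equiv.Perm (Fin n)) (r : Fin n) (j : Fin m) :
    permExponent c π (toLex (r, j)) = if c (π.symm r) = j then 1 else 0 := by
  rw [permExponent, Finsupp.finsetSum_apply, Finset.sum_eq_single (π.symm r)]
  · simp [Finsupp.single_apply]
  · intro b _ hb
    rw [Finsupp.single_apply, if_neg]
    intro h
    rw [toLex.injective.eq_iff, Prod.mk.injEq] at h
    exact hb (by rw [← h.1, Equiv.symm_apply_apply])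
  · simp

/-- In the first row that leaves the diagonal, the earlier columns are already taken by the earlier
rows. So this row uses a column further right, and the first difference of the exponents is at its
diagonal variable. -/
theorem permExponent_lt {c : Fin n → Fin m} (hc : StrictMono c) {π : Equiv.Perm (Fin n)}
    (hπ : π ≠ 1) : toLex (permExponent c π) < toLex (permExponent c 1) := by
  have hπ' : ∃ r, π.symm r ≠ r := by
    by_contra! h
    exact hπ (Equiv.ext fun r => (π.symm_apply_eq.mp (h r)).symm)
  obtain ⟨r, hr, hmin⟩ := WellFounded.has_min (wellFounded_lt (α := Fin n))
    {r | π.symm r ≠ r} hπ'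
  have hlt : ∀ s < r, π.symm s = s := fun s hs => by
    by_contra h
    exact hmin s h hs
  have hgt : r < π.symm r := by
    by_contra h
    have h1 : π.symm r < r := lt_of_le_of_ne (not_lt.mp h) hr
    exact hr (π.symm.injective (hlt _ h1))
  rw [Finsupp.Lex.lt_iff]
  refine ⟨toLex (r, c r), fun x hx => ?_, ?_⟩
  · obtain ⟨⟨s, j⟩, rfl⟩ := toLex.surjective x
    rw [Prod.Lex.lt_iff] at hx
    simp only [ofLex_toLex] at hx ⊢
    rw [permExponent_apply, permExponent_apply]
    rcases hx with hs | ⟨hs, hj⟩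
    · rw [hlt s hs]; rfl
    · subst hs
      rw [if_neg (hj.trans (hc hgt)).ne', if_neg]
      exact hj.ne'
  · simp only [ofLex_toLex]
    rw [permExponent_apply, permExponent_apply, if_neg (hc hgt).ne']
    exact Nat.lt_of_lt_of_eq one_pos (if_pos rfl).symm

/-- The exponent of the diagonal term of the maximal minor on the columns `σ`. -/
noncomputable def diagExponent (σ : Finset (Fin m)) (h : σ.card = n) : (Fin n ×ₗ Fin m) →₀ ℕ :=
  permExponent (σ.orderEmbOfFin h) 1

theorem diagExponent_apply (σ : Finset (Fin m)) (h : σ.card = n) (r : Fin n) (j : Fin m) :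
    diagExponent σ h (toLex (r, j)) = if σ.orderEmbOfFin h r = j then 1 else 0 :=
  permExponent_apply _ _ _ _

variable (k : Type*) [Field k]

theorem maximalMinor_eq_sum (σ : Finset (Fin m)) (h : σ.card = n) :
    maximalMinor k σ h = ∑ π : Equiv.Perm (Fin n),
      monomial (permExponent (σ.orderEmbOfFin h) π) ((Equiv.Perm.sign π : ℤ) : k) := by
  rw [maximalMinor, Matrix.det_apply']
  refine Finset.sum_congr rfl fun π _ => ?_
  have h1 : ∏ i, (genericMatrix k n m).submatrix id (σ.orderEmbOfFin h) (π i) i =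
      monomial (permExponent (σ.orderEmbOfFin h) π) (1 : k) := by
    rw [permExponent, monomial_sum_one]
    rfl
  rw [h1, ← map_intCast (C : k →+* GenericRing k n m), C_mul_monomial, mul_one]

variable {k}

theorem le_diagExponent_of_mem_support {σ : Finset (Fin m)} {h : σ.card = n}
    {u : (Fin n ×ₗ Fin m) →₀ ℕ} (hu : u ∈ (maximalMinor k σ h).support) :
    toLex u ≤ toLex (diagExponent σ h) := by
  rw [maximalMinor_eq_sum] at hu
  obtain ⟨π, -, hπ⟩ := Finset.mem_biUnion.mp (support_sum hu)
  have hu' := Finset.mem_singleton.mp (support_monomial_subset hπ)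
  subst hu'
  by_cases h1 : π = 1
  · subst h1; exact le_rfl
  · exact (permExponent_lt (σ.orderEmbOfFin h).strictMono h1).le

theorem coeff_diagExponent_maximalMinor (σ : Finset (Fin m)) (h : σ.card = n) :
    coeff (diagExponent σ h) (maximalMinor k σ h) = 1 := by
  rw [maximalMinor_eq_sum, coeff_sum, Finset.sum_eq_single 1]
  · simp [diagExponent]
  · intro π _ hπ
    rw [coeff_monomial, if_neg]
    intro he
    exact (permExponent_lt (σ.orderEmbOfFin h).strictMono hπ).ne (congrArg toLex he)
  · simp

/-- Each monomial of a minor involves all the columns of that minor and no others, so it determines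
the column set. This prevents cancellation of diagonal terms in combinations of minors. -/
theorem coeff_diagExponent_maximalMinor_of_ne {σ ρ : Finset (Fin m)} (hσ : σ.card = n)
    (hρ : ρ.card = n) (hne : σ ≠ ρ) : coeff (diagExponent σ hσ) (maximalMinor k ρ hρ) = 0 := by
  rw [maximalMinor_eq_sum, coeff_sum]
  refine Finset.sum_eq_zero fun π _ => ?_
  rw [coeff_monomial, if_neg]
  intro he
  have h1 : ∀ r, ρ.orderEmbOfFin hρ (π.symm r) = σ.orderEmbOfFin hσ r := fun r => by
    have := DFunLike.congr_fun he (toLex (r, σ.orderEmbOfFin hσ r))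
    rw [permExponent_apply, diagExponent_apply, if_pos rfl] at this
    by_contra h
    simp [h] at this
  refine hne (Finset.eq_of_subset_of_card_le (fun j hj => ?_) (by rw [hσ, hρ]))
  rw [← Finset.mem_coe, ← Finset.range_orderEmbOfFin σ hσ] at hj
  obtain ⟨r, rfl⟩ := hj
  rw [← h1]
  exact Finset.orderEmbOfFin_mem _ _ _

theorem lex_degree_maximalMinor (σ : Finset (Fin m)) (h : σ.card = n) :
    MonomialOrder.lex.degree (maximalMinor k σ h) = diagExponent σ h := by
  refine MonomialOrder.lex.toSyn.injective (le_antisymm ?_ ?_)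
  · exact MonomialOrder.lex.degree_le_iff.mpr fun u hu => le_diagExponent_of_mem_support hu
  · refine MonomialOrder.lex.le_degree ?_
    rw [mem_support_iff, coeff_diagExponent_maximalMinor]
    exact one_ne_zero

theorem lex_leadingTerm_maximalMinor (σ : Finset (Fin m)) (h : σ.card = n) :
    MonomialOrder.lex.leadingTerm (maximalMinor k σ h) = monomial (diagExponent σ h) 1 := by
  rw [MonomialOrder.leadingTerm, MonomialOrder.leadingCoeff, lex_degree_maximalMinor,
    coeff_diagExponent_maximalMinor]

end Minors

/-! ### The initial ideal in degrees at most `n` -/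

section InitialIdeal

variable {k : Type*} [Field k] {n m : ℕ} {Δ : PreAbstractSimplicialComplex (Fin m)}

-- The generators are forms of degree `n`, so up to degree `n` the coefficients of a representation
-- matter only through their constant terms.
open Classical in
theorem homogeneousComponent_mem_determinantalFacetIdeal {q : GenericRing k n m}
    (hq : q ∈ determinantalFacetIdeal k n Δ) :
    (∀ e < n, homogeneousComponent e q = 0) ∧
    ∃ c : {σ : Finset (Fin m) // Maximal (· ∈ Δ) σ ∧ σ.card = n} → k,
      homogeneousComponent n q = ∑ σ, C (c σ) * maximalMinor k σ.1 σ.2.2 := by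
  have hJ : determinantalFacetIdeal k n Δ = Ideal.span (Set.range
      fun σ : {σ : Finset (Fin m) // Maximal (· ∈ Δ) σ ∧ σ.card = n} =>
        maximalMinor k σ.1 σ.2.2) := by
    rw [determinantalFacetIdeal]
    congr 1
    ext p
    constructor
    · rintro ⟨σ, h, hσ, rfl⟩
      exact ⟨⟨σ, hσ, h⟩, rfl⟩
    · rintro ⟨σ, rfl⟩
      exact ⟨σ.1, σ.2.2, σ.2.1, rfl⟩
  rw [hJ, Ideal.mem_span_range_iff_exists_fun] at hq
  obtain ⟨c, rfl⟩ := hq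
  refine ⟨fun e he => ?_, fun σ => coeff 0 (c σ), ?_⟩
  · rw [map_sum]
    refine Finset.sum_eq_zero fun σ _ => ?_
    rw [homogeneousComponent_mul_of_isHomogeneous _ (maximalMinor_isHomogeneous k σ.1 σ.2.2) he.le,
      if_neg he.ne']
  · rw [map_sum]
    refine Finset.sum_congr rfl fun σ _ => ?_
    rw [homogeneousComponent_mul_of_isHomogeneous _ (maximalMinor_isHomogeneous k σ.1 σ.2.2) le_rfl,
      if_pos rfl]

theorem coeff_eq_coeff_homogeneousComponent (q : GenericRing k n m) (u : (Fin n ×ₗ Fin m) →₀ ℕ) :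
    coeff u q = coeff u (homogeneousComponent u.degree q) := by
  rw [coeff_homogeneousComponent, if_pos rfl]

theorem degree_diagExponent (σ : Finset (Fin m)) (h : σ.card = n) :
    (diagExponent σ h).degree = n := by
  simp [diagExponent, permExponent]

theorem le_degree_lex_degree {q : GenericRing k n m} (hq : q ∈ determinantalFacetIdeal k n Δ)
    (h0 : q ≠ 0) : n ≤ (MonomialOrder.lex.degree q).degree := by
  by_contra! h
  have h1 := MonomialOrder.lex.coeff_degree_ne_zero_iff.mpr h0
  rw [coeff_eq_coeff_homogeneousComponent,
    (homogeneousComponent_mem_determinantalFacetIdeal hq).1 _ h] at h1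
  exact h1 (coeff_zero _)

/-- Here `q` need not be homogeneous. Its leading monomial occurs in some minor `σ` with nonzero
coefficient in the degree `n` component, so it is at most the diagonal of `σ`. That diagonal
survives in `q`, which gives the reverse inequality. -/
theorem exists_lex_degree_eq_diagExponent {q : GenericRing k n m}
    (hq : q ∈ determinantalFacetIdeal k n Δ) (h0 : q ≠ 0)
    (hn : (MonomialOrder.lex.degree q).degree = n) :
    ∃ (σ : Finset (Fin m)) (h : σ.card = n), Maximal (· ∈ Δ) σ ∧
      MonomialOrder.lex.degree q = diagExponent σ h := by
  classical
  obtain ⟨-, c, hc⟩ := homogeneousComponent_mem_determinantalFacetIdeal hq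
  have h1 := MonomialOrder.lex.coeff_degree_ne_zero_iff.mpr h0
  rw [coeff_eq_coeff_homogeneousComponent, hn, hc, coeff_sum] at h1
  obtain ⟨σ, -, hσ⟩ := Finset.exists_ne_zero_of_sum_ne_zero h1
  rw [coeff_C_mul] at hσ
  refine ⟨σ.1, σ.2.2, σ.2.1, MonomialOrder.lex.toSyn.injective (le_antisymm ?_ ?_)⟩
  · exact le_diagExponent_of_mem_support (mem_support_iff.mpr (right_ne_zero_of_mul hσ))
  · refine MonomialOrder.lex.le_degree (mem_support_iff.mpr ?_)
    rw [coeff_eq_coeff_homogeneousComponent, degree_diagExponent, hc, coeff_sum,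
      Finset.sum_eq_single σ]
    · rw [coeff_C_mul, coeff_diagExponent_maximalMinor, mul_one]
      exact left_ne_zero_of_mul hσ
    · intro ρ _ hρ
      rw [coeff_C_mul, coeff_diagExponent_maximalMinor_of_ne, mul_zero]
      exact fun h => hρ (Subtype.ext h.symm)
    · simp

theorem exists_le_of_mem_lexInitialIdeal {J : Ideal (GenericRing k n m)} {p : GenericRing k n m}
    (hp : p ∈ lexInitialIdeal J) {u : (Fin n ×ₗ Fin m) →₀ ℕ} (hu : u ∈ p.support) :
    ∃ q ∈ J, q ≠ 0 ∧ MonomialOrder.lex.degree q ≤ u := by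
  have h1 : lexInitialIdeal J ≤ Ideal.span ((fun s => monomial s (1 : k)) ''
      {s | ∃ q ∈ J, q ≠ 0 ∧ MonomialOrder.lex.degree q = s}) := by
    refine Ideal.span_le.mpr ?_
    rintro _ ⟨q, hq, rfl⟩
    by_cases h0 : q = 0
    · simp [h0]
    · rw [MonomialOrder.leadingTerm, ← mul_one (MonomialOrder.lex.leadingCoeff q),
        ← C_mul_monomial]
      exact Ideal.mul_mem_left _ _ (Ideal.subset_span ⟨_, ⟨q, hq, h0, rfl⟩, rfl⟩)
  obtain ⟨_, ⟨q, hq, h0, rfl⟩, hs⟩ := mem_ideal_span_monomial_image.mp (h1 hp) u hu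
  exact ⟨q, hq, h0, hs⟩

theorem degree_eq_of_mem_support {p : GenericRing k n m} {e : ℕ} (hp : p.IsHomogeneous e)
    {u : (Fin n ×ₗ Fin m) →₀ ℕ} (hu : u ∈ p.support) : u.degree = e := by
  rw [Finsupp.degree_eq_weight_one]
  exact hp (mem_support_iff.mp hu)

theorem le_of_mem_lexInitialIdeal (p : GenericRing k n m)
    (hp : p ∈ lexInitialIdeal (determinantalFacetIdeal k n Δ)) (h0 : p ≠ 0) (e : ℕ)
    (he : p.IsHomogeneous e) : n ≤ e := by
  obtain ⟨u, hu⟩ := support_nonempty.mpr h0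
  obtain ⟨q, hq, hq0, hle⟩ := exists_le_of_mem_lexInitialIdeal hp hu
  rw [← degree_eq_of_mem_support he hu]
  exact (le_degree_lex_degree hq hq0).trans (Finsupp.degree_mono hle)

/-- Each monomial of a degree `n` form in the initial ideal is divisible by a leading monomial of an
element of `J_Δ`. The latter has degree at least `n`, so the two are equal. -/
theorem mem_lexInitialIdeal_and_isHomogeneous_iff (p : GenericRing k n m) :
    p ∈ lexInitialIdeal (determinantalFacetIdeal k n Δ) ∧ p.IsHomogeneous n ↔
      p ∈ Submodule.span k {p | ∃ (σ : Finset (Fin m)) (h : σ.card = n),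
        Maximal (· ∈ Δ) σ ∧ p = MonomialOrder.lex.leadingTerm (maximalMinor k σ h)} := by
  constructor
  · rintro ⟨hp, hn⟩
    rw [p.as_sum]
    refine Submodule.sum_mem _ fun u hu => ?_
    obtain ⟨q, hq, hq0, hle⟩ := exists_le_of_mem_lexInitialIdeal hp hu
    have hun := degree_eq_of_mem_support hn hu
    have hqn := le_degree_lex_degree hq hq0
    obtain ⟨v, rfl⟩ := le_iff_exists_add.mp hle
    rw [map_add] at hun
    have hv : v = 0 := (Finsupp.degree_eq_zero_iff v).mp (by omega)
    subst hv
    rw [add_zero]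
    obtain ⟨σ, h, hσ, he⟩ := exists_lex_degree_eq_diagExponent hq hq0 (by simpa using hun)
    rw [he, ← mul_one (coeff _ p), ← smul_eq_mul, ← smul_monomial]
    exact Submodule.smul_mem _ _ (Submodule.subset_span
      ⟨σ, h, hσ, (lex_leadingTerm_maximalMinor σ h).symm⟩)
  · intro hp
    induction hp using Submodule.span_induction with
    | mem p hp =>
      obtain ⟨σ, h, hσ, rfl⟩ := hp
      exact ⟨Ideal.subset_span ⟨_, Ideal.subset_span ⟨σ, h, hσ, rfl⟩, rfl⟩,
        leadingTerm_isHomogeneous _ (maximalMinor_isHomogeneous k σ h)⟩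
    | zero => exact ⟨zero_mem _, isHomogeneous_zero _ _ _⟩
    | add p q _ _ hp hq => exact ⟨add_mem hp.1 hq.1, hp.2.add hq.2⟩
    | smul r p _ hp =>
      rw [smul_eq_C_mul]
      refine ⟨Ideal.mul_mem_left _ _ hp.1, ?_⟩
      have := (isHomogeneous_C (Fin n ×ₗ Fin m) r).mul hp.2
      rwa [zero_add] at this

end InitialIdeal

/-! ### Cells

A basis element `g^{*(α)} ⊗ f_σ` is encoded by the set of the pairs `(a, j)` with `j` in the `a`-th
of the consecutive blocks of `α_a + 1` elements into which `σ` is divided: a face of the product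
of `n` simplices. In these terms the differential removes points. -/

section Cells

variable {n m : ℕ}

/-- The row of a variable. -/
def rowOf (s : Fin n ×ₗ Fin m) : Fin n := (ofLex s).1

/-- The column of a variable. -/
def colOf (s : Fin n ×ₗ Fin m) : Fin m := (ofLex s).2

@[simp] theorem rowOf_toLex (q : Fin n × Fin m) : rowOf (toLex q) = q.1 := rfl

@[simp] theorem colOf_toLex (q : Fin n × Fin m) : colOf (toLex q) = q.2 := rfl

theorem eq_of_rowOf_eq_of_colOf_eq {s t : Fin n ×ₗ Fin m} (hr : rowOf s = rowOf t)
    (hc : colOf s = colOf t) : s = t :=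
  ofLex.injective (Prod.ext hr hc)

theorem lt_iff_rowOf_colOf {s t : Fin n ×ₗ Fin m} :
    s < t ↔ rowOf s < rowOf t ∨ rowOf s = rowOf t ∧ colOf s < colOf t :=
  Prod.Lex.lt_iff

/-- Every row is met, and the columns met by a row lie before those met by the later rows. -/
structure IsStaircase (U : Finset (Fin n ×ₗ Fin m)) : Prop where
  exists_row : ∀ a, ∃ s ∈ U, rowOf s = a
  col_lt : ∀ s ∈ U, ∀ t ∈ U, rowOf s < rowOf t → colOf s < colOf t

/-- A staircase whose columns form a face of `Γ`. -/
structure IsCell (Γ : PreAbstractSimplicialComplex (Fin m)) (U : Finset (Fin n ×ₗ Fin m)) : Prop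
    extends IsStaircase U where
  mem : U.image colOf ∈ Γ

namespace IsStaircase

variable {U : Finset (Fin n ×ₗ Fin m)} (hU : IsStaircase U)

include hU

/-- On a staircase, ordering by columns and ordering the variables lexicographically are the same.
Hence a position in `σ`, and with it the sign in the differential, can be counted inside `U`. -/
theorem colOf_lt_iff {s t : Fin n ×ₗ Fin m} (hs : s ∈ U) (ht : t ∈ U) :
    colOf s < colOf t ↔ s < t := by
  rw [lt_iff_rowOf_colOf]
  constructor
  · intro h
    rcases lt_trichotomy (rowOf s) (rowOf t) with h1 | h1 | h1
    · exact Or.inl h1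
    · exact Or.inr ⟨h1, h⟩
    · exact absurd (hU.col_lt t ht s hs h1) h.not_gt
  · rintro (h | h)
    · exact hU.col_lt s hs t ht h
    · exact h.2

theorem colOf_injOn : Set.InjOn colOf (U : Set (Fin n ×ₗ Fin m)) := by
  intro s hs t ht h
  by_contra hne
  rcases lt_or_gt_of_ne hne with h1 | h1
  · exact ((hU.colOf_lt_iff hs ht).mpr h1).ne h
  · exact ((hU.colOf_lt_iff ht hs).mpr h1).ne' h

theorem card_image_colOf : (U.image colOf).card = U.card :=
  Finset.card_image_of_injOn hU.colOf_injOn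

theorem card_filter_lt {s : Fin n ×ₗ Fin m} (hs : s ∈ U) :
    ((U.image colOf).filter (· < colOf s)).card = (U.filter (· < s)).card := by
  have : (U.image colOf).filter (· < colOf s) = (U.filter (· < s)).image colOf := by
    ext j
    simp only [Finset.mem_filter, Finset.mem_image]
    constructor
    · rintro ⟨⟨t, ht, rfl⟩, h⟩
      exact ⟨t, ⟨ht, (hU.colOf_lt_iff ht hs).mp h⟩, rfl⟩
    · rintro ⟨t, ⟨ht, h⟩, rfl⟩
      exact ⟨⟨t, ht, rfl⟩, (hU.colOf_lt_iff ht hs).mpr h⟩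
  rw [this, Finset.card_image_of_injOn (hU.colOf_injOn.mono
    (Finset.coe_subset.mpr (Finset.filter_subset _ _)))]

theorem image_colOf_erase {s : Fin n ×ₗ Fin m} (hs : s ∈ U) :
    (U.erase s).image colOf = (U.image colOf).erase (colOf s) := by
  ext j
  simp only [Finset.mem_image, Finset.mem_erase]
  constructor
  · rintro ⟨t, ⟨hne, ht⟩, rfl⟩
    exact ⟨fun h => hne (hU.colOf_injOn ht hs h), t, ht, rfl⟩
  · rintro ⟨hne, t, ht, rfl⟩
    exact ⟨t, ⟨fun h => hne (h ▸ rfl), ht⟩, rfl⟩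

omit hU in
theorem of_subset {U' U : Finset (Fin n ×ₗ Fin m)} (hU : IsStaircase U) (h : U' ⊆ U)
    (hr : ∀ a, ∃ s ∈ U', rowOf s = a) : IsStaircase U' :=
  ⟨hr, fun s hs t ht => hU.col_lt s (h hs) t (h ht)⟩

theorem exists_row_erase {s t : Fin n ×ₗ Fin m} (ht : t ∈ U) (hne : t ≠ s)
    (hr : rowOf t = rowOf s) (a : Fin n) : ∃ x ∈ U.erase s, rowOf x = a := by
  obtain ⟨x, hx, rfl⟩ := hU.exists_row a
  by_cases hxs : x = s
  · exact ⟨t, Finset.mem_erase.mpr ⟨hne, ht⟩, by rw [hr, hxs]⟩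
  · exact ⟨x, Finset.mem_erase.mpr ⟨hxs, hx⟩, rfl⟩

end IsStaircase

theorem IsCell.of_subset {Γ : PreAbstractSimplicialComplex (Fin m)}
    {U' U : Finset (Fin n ×ₗ Fin m)} (hU : IsCell Γ U) (h : U' ⊆ U)
    (hr : ∀ a, ∃ s ∈ U', rowOf s = a) (hne : U'.Nonempty) : IsCell Γ U' where
  toIsStaircase := hU.toIsStaircase.of_subset h hr
  mem := (Γ.isRelLowerSet_faces hU.mem).2 (Finset.image_subset_image h) (hne.image _)

end Cells

theorem card_filter_lt_orderEmbOfFin {α : Type*} [LinearOrder α] (σ : Finset α) {l : ℕ}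
    (h : σ.card = l) (p : Fin l) : (σ.filter (· < σ.orderEmbOfFin h p)).card = p := by
  have : σ.filter (· < σ.orderEmbOfFin h p) =
      (Finset.Iio p).map (σ.orderEmbOfFin h).toEmbedding := by
    ext j
    simp only [Finset.mem_filter, Finset.mem_map, Finset.mem_Iio, RelEmbedding.coe_toEmbedding]
    constructor
    · rintro ⟨hj, hlt⟩
      rw [← Finset.mem_coe, ← Finset.range_orderEmbOfFin σ h] at hj
      obtain ⟨q, rfl⟩ := hj
      exact ⟨q, (σ.orderEmbOfFin h).lt_iff_lt.mp hlt, rfl⟩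
    · rintro ⟨q, hq, rfl⟩
      exact ⟨Finset.orderEmbOfFin_mem _ _ _, (σ.orderEmbOfFin h).lt_iff_lt.mpr hq⟩
  rw [this, Finset.card_map, Fin.card_Iio]

/-! ### Blocks -/

section Blocks

variable {n : ℕ} (α : Fin n → ℕ)

/-- The first position of the `a`-th block. -/
def blockStart (a : Fin n) : ℕ := a + ∑ b ∈ Finset.Iio a, α b

/-- The last position of the `a`-th block. -/
def blockEnd (a : Fin n) : ℕ := a + ∑ b ∈ Finset.Iic a, α b

theorem blockEnd_eq (a : Fin n) : blockEnd α a = blockStart α a + α a := by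
  rw [blockEnd, blockStart, ← Finset.Iio_insert, Finset.sum_insert (by simp)]
  ring

theorem blockEnd_lt_blockStart {a b : Fin n} (h : a < b) : blockEnd α a < blockStart α b := by
  rw [blockEnd, blockStart]
  have h1 : ∑ c ∈ Finset.Iic a, α c ≤ ∑ c ∈ Finset.Iio b, α c :=
    Finset.sum_le_sum_of_subset fun c hc =>
      Finset.mem_Iio.mpr ((Finset.mem_Iic.mp hc).trans_lt h)
  have h2 : (a : ℕ) < b := h
  omega

theorem blockEnd_lt {i : ℕ} (h : ∑ a, α a = i) (a : Fin n) : blockEnd α a < n + i := by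
  rw [blockEnd]
  have h1 : ∑ c ∈ Finset.Iic a, α c ≤ ∑ c, α c :=
    Finset.sum_le_sum_of_subset (Finset.subset_univ _)
  have h2 : (a : ℕ) < n := a.2
  omega

theorem blockStart_eq_sum (a : Fin n) : blockStart α a = ∑ b ∈ Finset.Iio a, (α b + 1) := by
  rw [blockStart, Finset.sum_add_distrib, add_comm]
  simp

theorem blockEnd_add_one_eq_sum (a : Fin n) :
    blockEnd α a + 1 = ∑ b ∈ Finset.Iic a, (α b + 1) := by
  rw [blockEnd, Finset.sum_add_distrib]
  simp
  ring

theorem card_filter_block {i : ℕ} (h : ∑ a, α a = i) (a : Fin n) :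
    (Finset.univ.filter fun p : Fin (n + i) =>
      blockStart α a ≤ p ∧ (p : ℕ) ≤ blockEnd α a).card = α a + 1 := by
  have h1 : (Finset.univ.filter fun p : Fin (n + i) =>
      blockStart α a ≤ p ∧ (p : ℕ) ≤ blockEnd α a).map Fin.valEmbedding =
      Finset.Icc (blockStart α a) (blockEnd α a) := by
    ext x
    simp only [Finset.mem_map, Finset.mem_filter, Finset.mem_univ, true_and, Finset.mem_Icc,
      Fin.valEmbedding_apply]
    constructor
    · rintro ⟨p, hp, rfl⟩
      exact hp
    · intro hx
      exact ⟨⟨x, hx.2.trans_lt (blockEnd_lt α h a)⟩, hx, rfl⟩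
  rw [← Finset.card_map, h1, Nat.card_Icc, blockEnd_eq]
  omega

theorem mem_sparsePairs {l : ℕ} {q : Fin n × Fin l} :
    q ∈ sparsePairs α l ↔ 0 < α q.1 ∧ blockStart α q.1 ≤ q.2 ∧ (q.2 : ℕ) ≤ blockEnd α q.1 := by
  simp [sparsePairs, blockStart, blockEnd]

end Blocks

/-! ### Basis elements correspond to cells -/

namespace SparseIndex

variable {m n i : ℕ} {Γ : PreAbstractSimplicialComplex (Fin m)}

/-- The cell that belongs to a basis element. -/
def cell (b : SparseIndex Γ n i) : Finset (Fin n ×ₗ Fin m) :=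
  Finset.univ.filter fun s => ∃ p : Fin (n + i), b.vertex p = colOf s ∧
    blockStart b.α (rowOf s) ≤ p ∧ (p : ℕ) ≤ blockEnd b.α (rowOf s)

theorem mem_cell {b : SparseIndex Γ n i} {s : Fin n ×ₗ Fin m} :
    s ∈ b.cell ↔ ∃ p : Fin (n + i), b.vertex p = colOf s ∧
      blockStart b.α (rowOf s) ≤ p ∧ (p : ℕ) ≤ blockEnd b.α (rowOf s) := by
  simp [cell]

theorem vertex_strictMono (b : SparseIndex Γ n i) : StrictMono b.vertex :=
  (b.σ.orderEmbOfFin b.card_eq).strictMono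

theorem isStaircase_cell (b : SparseIndex Γ n i) : IsStaircase b.cell where
  exists_row a := by
    refine ⟨toLex (a, b.vertex ⟨blockEnd b.α a, blockEnd_lt _ b.sum_eq a⟩),
      mem_cell.mpr ⟨_, rfl, ?_, le_rfl⟩, rfl⟩
    simp [blockEnd_eq]
  col_lt s hs t ht h := by
    obtain ⟨p, hp, -, hp2⟩ := mem_cell.mp hs
    obtain ⟨q, hq, hq1, -⟩ := mem_cell.mp ht
    rw [← hp, ← hq]
    exact b.vertex_strictMono (hp2.trans_lt ((blockEnd_lt_blockStart _ h).trans_le hq1))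

theorem card_filter_rowOf_cell (b : SparseIndex Γ n i) (a : Fin n) :
    (b.cell.filter (rowOf · = a)).card = b.α a + 1 := by
  have h1 : b.cell.filter (rowOf · = a) = (Finset.univ.filter fun p : Fin (n + i) =>
      blockStart b.α a ≤ p ∧ (p : ℕ) ≤ blockEnd b.α a).image fun p => toLex (a, b.vertex p) := by
    ext s
    simp only [Finset.mem_filter, Finset.mem_image, Finset.mem_univ, true_and, mem_cell]
    constructor
    · rintro ⟨⟨p, hp, hp'⟩, rfl⟩
      exact ⟨p, hp', eq_of_rowOf_eq_of_colOf_eq rfl hp⟩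
    · rintro ⟨p, hp, rfl⟩
      exact ⟨⟨p, rfl, hp⟩, rfl⟩
  rw [h1, Finset.card_image_of_injective, card_filter_block _ b.sum_eq]
  intro p q h
  exact b.vertex_strictMono.injective (congrArg colOf h)

theorem card_cell (b : SparseIndex Γ n i) : b.cell.card = n + i := by
  rw [Finset.card_eq_sum_card_fiberwise (f := rowOf) (t := Finset.univ) (by simp),
    Finset.sum_congr rfl fun a _ => b.card_filter_rowOf_cell a, Finset.sum_add_distrib, b.sum_eq]
  simp [add_comm]

theorem image_colOf_cell (b : SparseIndex Γ n i) : b.cell.image colOf = b.σ := by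
  refine Finset.eq_of_subset_of_card_le (fun j hj => ?_) ?_
  · obtain ⟨s, hs, rfl⟩ := Finset.mem_image.mp hj
    obtain ⟨p, hp, -⟩ := mem_cell.mp hs
    rw [← hp]
    exact b.vertex_mem p
  · rw [b.isStaircase_cell.card_image_colOf, b.card_cell, b.card_eq]

theorem isCell_cell (b : SparseIndex Γ n i) : IsCell Γ b.cell where
  toIsStaircase := b.isStaircase_cell
  mem := b.image_colOf_cell ▸ b.mem

theorem cell_injective : Function.Injective (cell : SparseIndex Γ n i → _) := by
  intro b c h
  refine SparseIndex.ext (funext fun a => ?_) ?_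
  · have h1 := b.card_filter_rowOf_cell a
    rw [h, c.card_filter_rowOf_cell] at h1
    omega
  · rw [← b.image_colOf_cell, h, c.image_colOf_cell]

theorem val_eq_card_filter_lt {b : SparseIndex Γ n i} {s : Fin n ×ₗ Fin m} (hs : s ∈ b.cell)
    {p : Fin (n + i)} (h : b.vertex p = colOf s) : (p : ℕ) = (b.cell.filter (· < s)).card := by
  rw [← b.isStaircase_cell.card_filter_lt hs, b.image_colOf_cell, ← h]
  exact (card_filter_lt_orderEmbOfFin b.σ b.card_eq p).symm

/-- Take `α_a + 1` to be the number of points of `U` in row `a`. The position of a point counts the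
points before it, so it lies between the totals over the earlier rows and over the rows up to its
own, which is its block. -/
theorem exists_cell_eq {U : Finset (Fin n ×ₗ Fin m)} (hU : IsCell Γ U) (hc : U.card = n + i) :
    ∃ b : SparseIndex Γ n i, b.cell = U := by
  have hrow : ∀ a, ((U.filter (rowOf · = a)).card - 1) + 1 = (U.filter (rowOf · = a)).card := by
    intro a
    obtain ⟨s, hs, rfl⟩ := hU.exists_row a
    have : 0 < (U.filter (rowOf · = rowOf s)).card :=
      Finset.card_pos.mpr ⟨s, by simpa using hs⟩
    omega
  let b : SparseIndex Γ n i :=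
    { α := fun a => (U.filter (rowOf · = a)).card - 1
      σ := U.image colOf
      mem := hU.mem
      card_eq := by rw [hU.card_image_colOf, hc]
      sum_eq := by
        have h1 := Finset.card_eq_sum_card_fiberwise (f := rowOf) (s := U) (t := Finset.univ)
          (by simp)
        rw [hc, ← Finset.sum_congr rfl fun a _ => hrow a, Finset.sum_add_distrib] at h1
        simp only [Finset.sum_const, Finset.card_univ, Fintype.card_fin, smul_eq_mul,
          mul_one] at h1
        omega }
  refine ⟨b, (Finset.eq_of_subset_of_card_le (fun s hs => ?_) (by rw [b.card_cell, hc])).symm⟩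
  have hs' : colOf s ∈ Set.range b.vertex := by
    change colOf s ∈ Set.range ((U.image colOf).orderEmbOfFin _)
    rw [Finset.range_orderEmbOfFin]
    exact Finset.mem_coe.mpr (Finset.mem_image_of_mem _ hs)
  obtain ⟨p, hp⟩ := hs'
  have hp' : (p : ℕ) = (U.filter (· < s)).card := by
    rw [← hU.card_filter_lt hs, ← hp]
    exact (card_filter_lt_orderEmbOfFin b.σ b.card_eq p).symm
  have hfib : ∀ A : Finset (Fin n),
      (U.filter (rowOf · ∈ A)).card = ∑ a ∈ A, (b.α a + 1) := by
    intro A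
    rw [Finset.card_eq_sum_card_fiberwise (f := rowOf) (t := A) (by
      intro x hx; exact (Finset.mem_filter.mp hx).2)]
    refine Finset.sum_congr rfl fun a ha => ?_
    rw [Finset.filter_filter]
    refine Eq.trans ?_ (hrow a).symm
    congr 1
    ext x
    simp only [Finset.mem_filter]
    exact and_congr_right fun _ => ⟨fun h => h.2, fun h => ⟨h ▸ ha, h⟩⟩
  refine mem_cell.mpr ⟨p, hp, ?_, ?_⟩
  · rw [blockStart_eq_sum, ← hfib, hp']
    refine Finset.card_le_card fun x hx => ?_
    simp only [Finset.mem_filter, Finset.mem_Iio] at hx ⊢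
    exact ⟨hx.1, lt_iff_rowOf_colOf.mpr (Or.inl hx.2)⟩
  · rw [← Nat.lt_succ_iff, Nat.succ_eq_add_one, blockEnd_add_one_eq_sum, ← hfib, hp']
    refine Finset.card_lt_card ⟨fun x hx => ?_, fun h => ?_⟩
    · simp only [Finset.mem_filter, Finset.mem_Iic] at hx ⊢
      rcases lt_iff_rowOf_colOf.mp hx.2 with h | h
      exacts [⟨hx.1, h.le⟩, ⟨hx.1, h.1.le⟩]
    · have : s ∈ U.filter (· < s) := h (by simpa using hs)
      simp at this

/-- No shifting of blocks has to be followed: the set with one point removed is again a cell, hence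
belongs to some index, whose `α` and `σ` are found by counting rows and taking columns. -/
theorem cell_face (b : SparseIndex Γ n (i + 1)) {a : Fin n} {p : Fin (n + (i + 1))}
    (ha : 0 < b.α a) (h1 : blockStart b.α a ≤ p) (h2 : (p : ℕ) ≤ blockEnd b.α a) :
    (b.face a ha p).cell = b.cell.erase (toLex (a, b.vertex p)) := by
  set s : Fin n ×ₗ Fin m := toLex (a, b.vertex p) with hs
  have hsb : s ∈ b.cell := mem_cell.mpr ⟨p, rfl, h1, h2⟩
  have h3 : 1 < (b.cell.filter (rowOf · = a)).card := by
    rw [b.card_filter_rowOf_cell]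
    omega
  obtain ⟨t, ht, hts⟩ := Finset.exists_mem_ne h3 s
  rw [Finset.mem_filter] at ht
  have hcell : IsCell Γ (b.cell.erase s) :=
    b.isCell_cell.of_subset (Finset.erase_subset _ _)
      (b.isStaircase_cell.exists_row_erase ht.1 hts ht.2) ⟨t, Finset.mem_erase.mpr ⟨hts, ht.1⟩⟩
  obtain ⟨c, hc⟩ := exists_cell_eq (i := i) hcell
    (by rw [Finset.card_erase_of_mem hsb, b.card_cell]; omega)
  rw [← hc]
  congr 1
  refine SparseIndex.ext (funext fun a' => ?_) ?_
  · have h4 := c.card_filter_rowOf_cell a'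
    rw [hc, Finset.filter_erase] at h4
    change (b.α - Pi.single a 1 : Fin n → ℕ) a' = _
    by_cases haa : a' = a
    · subst haa
      have h5 : s ∈ b.cell.filter (rowOf · = a') := Finset.mem_filter.mpr ⟨hsb, rfl⟩
      rw [Finset.card_erase_of_mem h5, b.card_filter_rowOf_cell] at h4
      simp
      omega
    · rw [Finset.erase_eq_of_notMem (fun h => haa (Finset.mem_filter.mp h).2.symm),
        b.card_filter_rowOf_cell] at h4
      simp [haa]
      omega
  · change b.σ.erase (b.vertex p) = c.σ
    rw [← c.image_colOf_cell, hc, b.isStaircase_cell.image_colOf_erase hsb, b.image_colOf_cell]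
    rfl

end SparseIndex

/-! ### The differential in terms of cells -/

/-- The sign `(-1)^p`, where `p` is the number of elements of `U` before `s`. -/
def cellSign {V : Type*} [LinearOrder V] (A : Type*) [Ring A] (U : Finset V) (s : V) : A :=
  (-1) ^ (U.filter (· < s)).card

section Sign

variable {V : Type*} [LinearOrder V] {A : Type*} [CommRing A]

theorem cellSign_erase (U : Finset V) (s : V) : cellSign A (U.erase s) s = cellSign A U s := by
  rw [cellSign, cellSign]
  congr 2
  ext x
  simp only [Finset.mem_filter, Finset.mem_erase]
  exact ⟨fun h => ⟨h.1.2, h.2⟩, fun h => ⟨⟨h.2.ne, h.1⟩, h.2⟩⟩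

theorem cellSign_mul_self (U : Finset V) (s : V) : cellSign A U s * cellSign A U s = 1 := by
  rw [cellSign, ← mul_pow]
  simp

theorem cellSign_insert_of_lt {U : Finset V} {s t : V} (hs : s ∉ U) (h : s < t) :
    cellSign A (insert s U) t = -cellSign A U t := by
  rw [cellSign, cellSign, Finset.filter_insert, if_pos h, Finset.card_insert_of_notMem
    (fun h => hs (Finset.mem_filter.mp h).1), pow_succ]
  ring

theorem cellSign_insert_of_gt {U : Finset V} {s t : V} (h : t < s) :
    cellSign A (insert s U) t = cellSign A U t := by
  rw [cellSign, cellSign, Finset.filter_insert, if_neg h.not_gt]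

theorem cellSign_mul_cellSign_insert {U : Finset V} {s t : V} (hs : s ∉ U) (ht : t ∉ U)
    (hne : s ≠ t) : cellSign A U s * cellSign A (insert s U) t =
      -(cellSign A U t * cellSign A (insert t U) s) := by
  rcases lt_or_gt_of_ne hne with h | h
  · rw [cellSign_insert_of_lt hs h, cellSign_insert_of_gt h]
    ring
  · rw [cellSign_insert_of_lt ht h, cellSign_insert_of_gt h]
    ring

end Sign

section Differential

variable {k : Type*} [Field k] {n m : ℕ} {Γ : PreAbstractSimplicialComplex (Fin m)} {i : ℕ}

/-- A basis element has `b` as a face exactly when its cell adds one point to that of `b`, and the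
point is then unique. Since `mapDomain` extends `y` by zero to sets that are not cells, the sum may
run over all variables outside the cell. -/
theorem sparseDifferential_apply (y : SparseIndex Γ n (i + 1) →₀ GenericRing k n m)
    (b : SparseIndex Γ n i) :
    sparseDifferential k n Γ i y b = ∑ s ∈ b.cellᶜ, cellSign (GenericRing k n m) b.cell s * X s *
      y.mapDomain SparseIndex.cell (insert s b.cell) := by
  classical
  induction y using Finsupp.induction_linear with
  | zero => simp
  | add y z hy hz =>
    rw [map_add, Finsupp.add_apply, hy, hz, ← Finset.sum_add_distrib, Finsupp.mapDomain_add]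
    simp only [Finsupp.add_apply, mul_add]
  | single c r =>
    rw [Finsupp.mapDomain_single, sparseDifferential, Finsupp.linearCombination_single,
      Finsupp.smul_apply, Finsupp.finsetSum_apply, smul_eq_mul]
    have hface : ∀ q : {q // q ∈ sparsePairs c.α (n + (i + 1))},
        c.face q.1.1 (Finset.mem_filter.mp q.2).2.1 q.1.2 = b →
        toLex (q.1.1, c.vertex q.1.2) ∉ b.cell ∧
          insert (toLex (q.1.1, c.vertex q.1.2)) b.cell = c.cell := by
      rintro ⟨q, hq⟩ rfl
      have hq' := (mem_sparsePairs _).mp hq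
      rw [c.cell_face hq'.1 hq'.2.1 hq'.2.2]
      refine ⟨Finset.notMem_erase _ _, Finset.insert_erase ?_⟩
      exact SparseIndex.mem_cell.mpr ⟨q.2, rfl, hq'.2⟩
    by_cases h : ∃ s, s ∉ b.cell ∧ insert s b.cell = c.cell
    · obtain ⟨s, hs, hsc⟩ := h
      have huniq : ∀ t, insert t b.cell = c.cell → t ∉ b.cell → t = s := by
        intro t ht htb
        have : t ∈ insert s b.cell := by rw [hsc, ← ht]; exact Finset.mem_insert_self _ _
        exact (Finset.mem_insert.mp this).resolve_right htb
      have hsmem : s ∈ c.cell := hsc ▸ Finset.mem_insert_self _ _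
      have hber : c.cell.erase s = b.cell := by rw [← hsc, Finset.erase_insert hs]
      obtain ⟨p, hp, hp'⟩ := SparseIndex.mem_cell.mp hsmem
      have hα : 0 < c.α (rowOf s) := by
        have h1 := c.card_filter_rowOf_cell (rowOf s)
        have h2 := b.card_filter_rowOf_cell (rowOf s)
        rw [← hsc, Finset.filter_insert, if_pos rfl, Finset.card_insert_of_notMem
          (fun h => hs (Finset.mem_filter.mp h).1), h2] at h1
        omega
      have hq0 : ((rowOf s, p) : Fin n × Fin (n + (i + 1))) ∈ sparsePairs c.α (n + (i + 1)) :=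
        (mem_sparsePairs _).mpr ⟨hα, hp'⟩
      have hs_eq : (toLex (rowOf s, c.vertex p) : Fin n ×ₗ Fin m) = s :=
        eq_of_rowOf_eq_of_colOf_eq rfl hp
      rw [Finset.sum_eq_single s, hsc, Finsupp.single_eq_same,
        Finset.sum_eq_single ⟨(rowOf s, p), hq0⟩]
      · have hfb : c.face (rowOf s) hα p = b := by
          apply SparseIndex.cell_injective
          rw [c.cell_face hα hp'.1 hp'.2, hs_eq, hber]
        rw [hfb, Finsupp.single_eq_same, ← hber, cellSign_erase, cellSign,
          ← SparseIndex.val_eq_card_filter_lt hsmem hp, hs_eq]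
        ring
      · intro q _ hq
        rw [Finsupp.single_apply, if_neg]
        intro hb
        obtain ⟨h1, h2⟩ := hface q hb
        have h3 := huniq _ h2 h1
        have h4 : q.1.1 = rowOf s := congrArg rowOf h3
        refine hq (Subtype.ext (Prod.ext h4 ?_))
        exact c.vertex_strictMono.injective ((congrArg colOf h3).trans hp.symm)
      · intro h
        exact absurd (Finset.mem_attach _ _) h
      · intro t ht hts
        rw [Finsupp.single_apply, if_neg, mul_zero]
        exact fun h => hts (huniq t h.symm (Finset.mem_compl.mp ht))
      · intro h
        exact absurd (Finset.mem_compl.mpr hs) h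
    · push Not at h
      rw [Finset.sum_eq_zero, mul_zero, Finset.sum_eq_zero]
      · intro s hs
        rw [Finsupp.single_apply, if_neg, mul_zero]
        exact fun hc => h s (Finset.mem_compl.mp hs) hc.symm
      · intro q _
        rw [Finsupp.single_apply, if_neg]
        intro hb
        exact h _ (hface q hb).1 (hface q hb).2

theorem mapDomain_cell_eq_zero {A : Type*} [AddCommMonoid A] (y : SparseIndex Γ n i →₀ A)
    {U : Finset (Fin n ×ₗ Fin m)} (hU : ¬ (IsCell Γ U ∧ U.card = n + i)) :
    y.mapDomain SparseIndex.cell U = 0 := by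
  refine Finsupp.mapDomain_of_notMem_range _ _ ?_
  rintro ⟨b, rfl⟩
  exact hU ⟨b.isCell_cell, b.card_cell⟩

theorem mapDomain_cell {A : Type*} [AddCommMonoid A] (y : SparseIndex Γ n i →₀ A)
    (b : SparseIndex Γ n i) : y.mapDomain SparseIndex.cell b.cell = y b :=
  Finsupp.mapDomain_apply SparseIndex.cell_injective _ _

theorem mapDomain_cell_sparseDifferential (y : SparseIndex Γ n (i + 1) →₀ GenericRing k n m)
    {U : Finset (Fin n ×ₗ Fin m)} (hU : IsCell Γ U) (hc : U.card = n + i) :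
    (sparseDifferential k n Γ i y).mapDomain SparseIndex.cell U =
      ∑ s ∈ Uᶜ, cellSign (GenericRing k n m) U s * X s *
        y.mapDomain SparseIndex.cell (insert s U) := by
  obtain ⟨b, rfl⟩ := SparseIndex.exists_cell_eq hU hc
  rw [mapDomain_cell, sparseDifferential_apply]

/-- Adding `s` and then `t` cancels against adding `t` and then `s`. The inner formula remains valid
when `U ∪ s` is not a cell: as `U` already meets every row, no larger set `U ∪ {s, t}` is a cell
either, and both sides vanish. -/
theorem sparseDifferential_sparseDifferential
    (y : SparseIndex Γ n (i + 1 + 1) →₀ GenericRing k n m) :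
    sparseDifferential k n Γ i (sparseDifferential k n Γ (i + 1) y) = 0 := by
  ext1 b
  rw [sparseDifferential_apply, Finsupp.zero_apply]
  set U := b.cell with hUdef
  have h1 : ∀ s ∈ Uᶜ, cellSign (GenericRing k n m) U s * X s *
      (sparseDifferential k n Γ (i + 1) y).mapDomain SparseIndex.cell (insert s U) =
      ∑ t ∈ (insert s U)ᶜ, cellSign (GenericRing k n m) U s *
        cellSign (GenericRing k n m) (insert s U) t * (X s * X t) *
          y.mapDomain SparseIndex.cell (insert t (insert s U)) := by
    intro s hs
    by_cases hcell : IsCell Γ (insert s U)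
    · rw [mapDomain_cell_sparseDifferential y hcell (by
        rw [Finset.card_insert_of_notMem (Finset.mem_compl.mp hs), b.card_cell]; omega),
        Finset.mul_sum]
      refine Finset.sum_congr rfl fun t _ => ?_
      ring
    · rw [mapDomain_cell_eq_zero _ fun h => hcell h.1, mul_zero, Finset.sum_eq_zero]
      intro t _
      rw [mapDomain_cell_eq_zero _ fun h => hcell (h.1.of_subset (Finset.subset_insert _ _)
        (fun a => ?_) (Finset.insert_nonempty _ _)), mul_zero]
      obtain ⟨x, hx, hxa⟩ := b.isStaircase_cell.exists_row a
      exact ⟨x, Finset.mem_insert_of_mem hx, hxa⟩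
  rw [Finset.sum_congr rfl h1, Finset.sum_sigma']
  refine Finset.sum_involution (fun q _ => ⟨q.2, q.1⟩) ?_ ?_ ?_ ?_
  · rintro ⟨s, t⟩ hq
    simp only [Finset.mem_sigma, Finset.mem_compl, Finset.mem_insert, not_or] at hq
    dsimp only
    rw [cellSign_mul_cellSign_insert hq.1 hq.2.2 (Ne.symm hq.2.1), Finset.insert_comm]
    ring
  · rintro ⟨s, t⟩ hq _ h
    simp only [Finset.mem_sigma, Finset.mem_compl, Finset.mem_insert, not_or] at hq
    simp only [Sigma.mk.injEq, heq_eq_eq] at h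
    exact hq.2.1 h.1
  · rintro ⟨s, t⟩ hq
    simp only [Finset.mem_sigma, Finset.mem_compl, Finset.mem_insert, not_or] at hq ⊢
    exact ⟨hq.2.2, Ne.symm hq.2.1, hq.1⟩
  · rintro ⟨s, t⟩ _
    rfl

end Differential

/-! ### Combinatorics of staircases -/

section Staircases

variable {n m : ℕ} {W : Finset (Fin n ×ₗ Fin m)}

theorem rowOf_eq_of_lt_of_lt {s t x : Fin n ×ₗ Fin m} (h : rowOf s = rowOf t) (h1 : s < x)
    (h2 : x < t) : rowOf x = rowOf t := by
  refine le_antisymm ?_ (h ▸ ?_)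
  · rcases lt_iff_rowOf_colOf.mp h2 with h | h
    exacts [h.le, h.1.le]
  · rcases lt_iff_rowOf_colOf.mp h1 with h | h
    exacts [h.le, h.1.le]

theorem exists_lt_rowOf_eq (h : n < W.card) : ∃ s ∈ W, ∃ t ∈ W, s < t ∧ rowOf s = rowOf t := by
  obtain ⟨s, hs, t, ht, hne, hr⟩ := Finset.exists_ne_map_eq_of_card_lt_of_maps_to
    (s := W) (t := (Finset.univ : Finset (Fin n))) (f := rowOf) (by simpa using h) (by simp)
  rcases lt_or_gt_of_ne hne with h | h
  · exact ⟨s, hs, t, ht, h, hr⟩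
  · exact ⟨t, ht, s, hs, h, hr.symm⟩

theorem exists_adjacent_rowOf_eq (h : n < W.card) : ∃ s ∈ W, ∃ t ∈ W, s < t ∧
    rowOf s = rowOf t ∧ ∀ x ∈ W, ¬ (s < x ∧ x < t) := by
  obtain ⟨s, hs, t, ht, hst, hr⟩ := exists_lt_rowOf_eq h
  have hne : (W.filter fun x => s < x ∧ rowOf x = rowOf s).Nonempty :=
    ⟨t, Finset.mem_filter.mpr ⟨ht, hst, hr.symm⟩⟩
  have hm := Finset.min'_mem _ hne
  rw [Finset.mem_filter] at hm
  refine ⟨s, hs, _, hm.1, hm.2.1, hm.2.2.symm, fun x hx hlt => ?_⟩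
  refine absurd (Finset.min'_le _ x (Finset.mem_filter.mpr ⟨hx, hlt.1, ?_⟩)) hlt.2.not_ge
  rw [rowOf_eq_of_lt_of_lt hm.2.2.symm hlt.1 hlt.2, hm.2.2]

theorem rowOf_injOn_of_card {U : Finset (Fin n ×ₗ Fin m)} (hr : ∀ a, ∃ s ∈ U, rowOf s = a)
    (hc : U.card = n) : Set.InjOn rowOf (U : Set (Fin n ×ₗ Fin m)) := by
  refine Finset.injOn_of_card_image_eq ?_
  have : U.image rowOf = Finset.univ := Finset.eq_univ_iff_forall.mpr fun a => by
    simpa using hr a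
  rw [this, hc, Finset.card_univ, Fintype.card_fin]

/-- A staircase with `n + 1` elements has precisely two elements that can be removed, and these
are adjacent. -/
theorem IsStaircase.exists_removable (hW : IsStaircase W) (hc : W.card = n + 1) :
    ∃ s ∈ W, ∃ t ∈ W, s < t ∧ (∀ x ∈ W, ¬ (s < x ∧ x < t)) ∧
      (∀ a, ∃ x ∈ W.erase s, rowOf x = a) ∧ (∀ a, ∃ x ∈ W.erase t, rowOf x = a) ∧
      ∀ r ∈ W, (∀ a, ∃ x ∈ W.erase r, rowOf x = a) → r = s ∨ r = t := by
  obtain ⟨s, hs, t, ht, hst, hr, hadj⟩ := exists_adjacent_rowOf_eq (W := W) (by omega)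
  have hs' := hW.exists_row_erase ht hst.ne' hr.symm
  refine ⟨s, hs, t, ht, hst, hadj, hs', hW.exists_row_erase hs hst.ne hr, fun r hrW hrow => ?_⟩
  -- Without `s` each row contains exactly one point, so a removable point other than `s` must share
  -- its row with `s`, and is then `t`.
  have hinj := rowOf_injOn_of_card hs' (by rw [Finset.card_erase_of_mem hs, hc]; rfl)
  by_contra! hne
  obtain ⟨x, hx, hxr⟩ := hrow (rowOf r)
  rw [Finset.mem_erase] at hx
  have hrs : r ∈ W.erase s := Finset.mem_erase.mpr ⟨hne.1, hrW⟩
  by_cases hxs : x = s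
  · subst hxs
    exact hne.2 (hinj hrs (Finset.mem_erase.mpr ⟨hst.ne', ht⟩) (hxr.symm.trans hr))
  · exact hx.1 (hinj (Finset.mem_erase.mpr ⟨hxs, hx.2⟩) hrs hxr)

theorem cellSign_of_adjacent {V : Type*} [LinearOrder V] {A : Type*} [CommRing A] {W : Finset V}
    {s t : V} (hs : s ∈ W) (hst : s < t) (hadj : ∀ x ∈ W, ¬ (s < x ∧ x < t)) :
    cellSign A W t = -cellSign A W s := by
  have h : W.filter (· < t) = insert s (W.filter (· < s)) := by
    ext x
    simp only [Finset.mem_filter, Finset.mem_insert]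
    constructor
    · rintro ⟨hx, hxt⟩
      rcases lt_trichotomy x s with h | h | h
      · exact Or.inr ⟨hx, h⟩
      · exact Or.inl h
      · exact absurd ⟨h, hxt⟩ (hadj x hx)
    · rintro (rfl | h)
      · exact ⟨hs, hst⟩
      · exact ⟨h.1, h.2.trans hst⟩
  rw [cellSign, cellSign, h, Finset.card_insert_of_notMem (by simp), pow_succ]
  ring

/-- There are no `1`-nonfaces with more than `n` elements. -/
def HasAdjacentProperty (n : ℕ) (Γ : PreAbstractSimplicialComplex (Fin m)) : Prop :=
  ∀ σ : Finset (Fin m), n < σ.card → ∀ u ∈ σ, ∀ v ∈ σ, u < v → (∀ x ∈ σ, ¬ (u < x ∧ x < v)) →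
    σ.erase u ∈ Γ → σ.erase v ∈ Γ → σ ∈ Γ

theorem IsStaircase.isCell_of_adjacent {Γ : PreAbstractSimplicialComplex (Fin m)}
    (hΓ : HasAdjacentProperty n Γ) (hW : IsStaircase W) (hc : n < W.card) {s t : Fin n ×ₗ Fin m}
    (hs : s ∈ W) (ht : t ∈ W) (hst : s < t) (hadj : ∀ x ∈ W, ¬ (s < x ∧ x < t))
    (h1 : IsCell Γ (W.erase s)) (h2 : IsCell Γ (W.erase t)) : IsCell Γ W where
  toIsStaircase := hW
  mem := by
    refine hΓ _ (by rwa [hW.card_image_colOf]) (colOf s) (Finset.mem_image_of_mem _ hs) (colOf t)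
      (Finset.mem_image_of_mem _ ht) ((hW.colOf_lt_iff hs ht).mpr hst) ?_ ?_ ?_
    · intro j hj hlt
      obtain ⟨x, hx, rfl⟩ := Finset.mem_image.mp hj
      exact hadj x hx ⟨(hW.colOf_lt_iff hs hx).mp hlt.1, (hW.colOf_lt_iff hx ht).mp hlt.2⟩
    · rw [← hW.image_colOf_erase hs]
      exact h1.mem
    · rw [← hW.image_colOf_erase ht]
      exact h2.mem

end Staircases

/-! ### The augmentation in terms of cells -/

section Augmentation

variable {n m : ℕ}

/-- The exponent of the product of the variables in `U`. -/
noncomputable def cellExponent (U : Finset (Fin n ×ₗ Fin m)) : (Fin n ×ₗ Fin m) →₀ ℕ :=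
  ∑ s ∈ U, Finsupp.single s 1

theorem cellExponent_apply (U : Finset (Fin n ×ₗ Fin m)) (t : Fin n ×ₗ Fin m) :
    cellExponent U t = if t ∈ U then 1 else 0 := by
  simp [cellExponent, Finsupp.single_apply]

theorem cellExponent_insert {U : Finset (Fin n ×ₗ Fin m)} {s : Fin n ×ₗ Fin m} (hs : s ∉ U) :
    cellExponent (insert s U) = Finsupp.single s 1 + cellExponent U :=
  Finset.sum_insert hs

theorem cellExponent_eq_add_erase {W : Finset (Fin n ×ₗ Fin m)} {s : Fin n ×ₗ Fin m}
    (hs : s ∈ W) : cellExponent W = Finsupp.single s 1 + cellExponent (W.erase s) := by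
  rw [← cellExponent_insert (Finset.notMem_erase s W), Finset.insert_erase hs]

theorem subset_of_cellExponent_le {U W : Finset (Fin n ×ₗ Fin m)}
    (h : cellExponent U ≤ cellExponent W) : U ⊆ W := by
  intro s hs
  have := h s
  rw [cellExponent_apply, cellExponent_apply, if_pos hs] at this
  by_contra h'
  simp [h'] at this

theorem subset_insert_of_cellExponent_le {U W : Finset (Fin n ×ₗ Fin m)} {t : Fin n ×ₗ Fin m}
    (h : cellExponent U ≤ Finsupp.single t 1 + cellExponent W) : U ⊆ insert t W := by
  intro s hs
  have := h s
  rw [cellExponent_apply, if_pos hs, Finsupp.add_apply, cellExponent_apply,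
    Finsupp.single_apply] at this
  rw [Finset.mem_insert]
  by_contra! h'
  simp [h'.1.symm, h'.2] at this

variable {Γ : PreAbstractSimplicialComplex (Fin m)}

theorem diagExponent_eq_cellExponent (b : SparseIndex Γ n 0) :
    diagExponent b.σ b.card_eq = cellExponent b.cell := by
  have hα : ∀ a, b.α a = 0 := fun a => by
    have := b.sum_eq
    rw [Finset.sum_eq_zero_iff] at this
    exact this a (Finset.mem_univ a)
  have h1 : ∀ a, blockStart b.α a = a := fun a => by simp [blockStart, hα]
  have h2 : ∀ a, blockEnd b.α a = a := fun a => by simp [blockEnd, hα]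
  ext s
  obtain ⟨⟨r, j⟩, rfl⟩ := toLex.surjective s
  refine (diagExponent_apply b.σ b.card_eq r j).trans ?_
  rw [cellExponent_apply]
  refine if_congr ?_ rfl rfl
  rw [SparseIndex.mem_cell]
  simp only [rowOf_toLex, colOf_toLex, h1, h2]
  constructor
  · intro h
    exact ⟨r, h, le_rfl, le_rfl⟩
  · rintro ⟨p, hp, h3, h4⟩
    have : p = r := Fin.ext (le_antisymm h4 h3)
    subst this
    exact hp

variable {k : Type*} [Field k]

theorem sparseAugmentation_single (b : SparseIndex Γ n 0) :
    sparseAugmentation k n Γ (Finsupp.single b 1) = monomial (cellExponent b.cell) 1 := by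
  rw [sparseAugmentation, Finsupp.linearCombination_single, one_smul,
    ← diagExponent_eq_cellExponent]
  exact lex_leadingTerm_maximalMinor b.σ b.card_eq

open Classical in
theorem coeff_sparseAugmentation [Fintype (SparseIndex Γ n 0)] (u : (Fin n ×ₗ Fin m) →₀ ℕ)
    (y : SparseIndex Γ n 0 →₀ GenericRing k n m) :
    coeff u (sparseAugmentation k n Γ y) = ∑ b, if cellExponent b.cell ≤ u then
      coeff (u - cellExponent b.cell) (y b) else 0 := by
  rw [linearMap_eq_sum, coeff_sum]
  refine Finset.sum_congr rfl fun b _ => ?_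
  rw [sparseAugmentation_single, smul_eq_mul, coeff_mul_monomial', mul_one]

/-- The cells here all have `n` points and their monomials are squarefree, so one divides another
only if the cells coincide. -/
theorem sparseAugmentation_constVec_injective (x : SparseIndex Γ n 0 →₀ k)
    (hx : sparseAugmentation k n Γ (constVec k _ _ x) = 0) : x = 0 := by
  classical
  have := Fintype.ofFinite (SparseIndex Γ n 0)
  ext b
  have h := congrArg (coeff (cellExponent b.cell)) hx
  rw [coeff_sparseAugmentation, Finset.sum_eq_single b] at h
  · simpa using h
  · intro c _ hc
    split_ifs with hle
    · have h1 := Finset.eq_of_subset_of_card_le (subset_of_cellExponent_le hle)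
        (by rw [b.card_cell, c.card_cell])
      exact absurd (SparseIndex.cell_injective h1) hc
    · rfl
  · simp

theorem sparseDifferential_single_apply {i : ℕ} {c : SparseIndex Γ n (i + 1)}
    {b : SparseIndex Γ n i} {s : Fin n ×ₗ Fin m} (hs : s ∈ c.cell) (hb : b.cell = c.cell.erase s) :
    sparseDifferential k n Γ i (Finsupp.single c 1) b =
      cellSign (GenericRing k n m) c.cell s * X s := by
  rw [sparseDifferential_apply, Finsupp.mapDomain_single, hb, Finset.sum_eq_single s,
    Finset.insert_erase hs, Finsupp.single_eq_same, cellSign_erase, mul_one]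
  · intro t ht hts
    rw [Finsupp.single_apply, if_neg, mul_zero]
    intro h
    have h1 : s ∈ insert t (c.cell.erase s) := h ▸ hs
    rw [Finset.mem_insert] at h1
    exact h1.elim (fun h => hts h.symm) (Finset.notMem_erase s _)
  · simp

theorem exists_of_sparseDifferential_single_ne_zero {i : ℕ} {c : SparseIndex Γ n (i + 1)}
    {b : SparseIndex Γ n i} (h : sparseDifferential k n Γ i (Finsupp.single c 1) b ≠ 0) :
    ∃ s ∈ c.cell, b.cell = c.cell.erase s := by
  rw [sparseDifferential_apply, Finsupp.mapDomain_single] at h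
  obtain ⟨s, hs, hne⟩ := Finset.exists_ne_zero_of_sum_ne_zero h
  rw [Finsupp.single_apply] at hne
  have h1 : c.cell = insert s b.cell := by
    by_contra h1
    simp [h1] at hne
  rw [h1]
  exact ⟨s, Finset.mem_insert_self _ _, (Finset.erase_insert (Finset.mem_compl.mp hs)).symm⟩

/-- A cell with `n + 1` points has just two faces, from removing adjacent points, so with opposite
signs. Multiplying back by the missing variable yields the monomial of the whole cell in both cases.
-/
theorem sparseAugmentation_sparseDifferential (y : SparseIndex Γ n 1 →₀ GenericRing k n m) :
    sparseAugmentation k n Γ (sparseDifferential k n Γ 0 y) = 0 := by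
  have := Fintype.ofFinite (SparseIndex Γ n 0)
  suffices h : sparseAugmentation k n Γ ∘ₗ sparseDifferential k n Γ 0 = 0 from
    LinearMap.congr_fun h y
  refine Finsupp.lhom_ext' fun c => LinearMap.ext_ring ?_
  change sparseAugmentation k n Γ (sparseDifferential k n Γ 0 (Finsupp.single c 1)) = 0
  obtain ⟨s, hs, t, ht, hst, hadj, hrs, hrt, honly⟩ :=
    c.isStaircase_cell.exists_removable c.card_cell
  have hcell : ∀ r ∈ c.cell, (∀ a, ∃ x ∈ c.cell.erase r, rowOf x = a) → (c.cell.erase r).Nonempty →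
      ∃ b : SparseIndex Γ n 0, b.cell = c.cell.erase r := fun r hr hrow hne =>
    SparseIndex.exists_cell_eq (c.isCell_cell.of_subset (Finset.erase_subset _ _) hrow hne)
      (by rw [Finset.card_erase_of_mem hr, c.card_cell]; rfl)
  obtain ⟨bs, hbs⟩ := hcell s hs hrs ⟨t, Finset.mem_erase.mpr ⟨hst.ne', ht⟩⟩
  obtain ⟨bt, hbt⟩ := hcell t ht hrt ⟨s, Finset.mem_erase.mpr ⟨hst.ne, hs⟩⟩
  have hne : bs ≠ bt := by
    rintro rfl
    have : s ∈ bs.cell := hbt ▸ Finset.mem_erase.mpr ⟨hst.ne, hs⟩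
    rw [hbs] at this
    exact Finset.notMem_erase _ _ this
  have hX : ∀ r ∈ c.cell, (X r : GenericRing k n m) * monomial (cellExponent (c.cell.erase r)) 1 =
      monomial (cellExponent c.cell) 1 := fun r hr => by
    rw [cellExponent_eq_add_erase hr, X, monomial_mul, mul_one]
  rw [linearMap_eq_sum, Fintype.sum_eq_add bs bt hne]
  · rw [sparseDifferential_single_apply hs hbs, sparseDifferential_single_apply ht hbt,
      sparseAugmentation_single, sparseAugmentation_single, hbs, hbt, smul_eq_mul, smul_eq_mul,
      mul_assoc, mul_assoc, hX s hs, hX t ht, cellSign_of_adjacent hs hst hadj]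
    ring
  · rintro b ⟨h1, h2⟩
    by_contra h
    obtain ⟨r, hr, hb⟩ := exists_of_sparseDifferential_single_ne_zero (left_ne_zero_of_smul h)
    rcases honly r hr (hb ▸ b.isStaircase_cell.exists_row) with rfl | rfl
    · exact h1 (SparseIndex.cell_injective (hb.trans hbs.symm))
    · exact h2 (SparseIndex.cell_injective (hb.trans hbt.symm))

end Augmentation

/-! ### Linear cycles -/

section LinearForms

variable {k τ : Type*} [Field k]

theorem eq_single_of_degree_eq_one {u : τ →₀ ℕ} (h : u.degree = 1) :
    ∃ s, u = Finsupp.single s 1 := by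
  have h0 : u ≠ 0 := by
    rintro rfl
    simp at h
  obtain ⟨s, hs⟩ := Finsupp.ne_iff.mp h0
  have hle : Finsupp.single s 1 ≤ u := by
    rw [Finsupp.single_le_iff]
    exact Nat.one_le_iff_ne_zero.mpr hs
  obtain ⟨v, rfl⟩ := le_iff_exists_add.mp hle
  rw [map_add, Finsupp.degree_single] at h
  have hv : v = 0 := (Finsupp.degree_eq_zero_iff v).mp (by omega)
  exact ⟨s, by rw [hv, add_zero]⟩

theorem eq_of_coeff_single_eq {p q : MvPolynomial τ k} (hp : p.IsHomogeneous 1)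
    (hq : q.IsHomogeneous 1) (h : ∀ s, coeff (Finsupp.single s 1) p = coeff (Finsupp.single s 1) q) :
    p = q := by
  ext u
  by_cases hu : u.degree = 1
  · obtain ⟨s, rfl⟩ := eq_single_of_degree_eq_one hu
    exact h s
  · rw [hp.coeff_eq_zero hu, hq.coeff_eq_zero hu]

theorem coeff_single_X_mul_C [DecidableEq τ] (s r : τ) (c : k) :
    coeff (Finsupp.single s 1) (X r * C c) = if r = s then c else 0 := by
  rw [mul_comm, coeff_C_mul, coeff_X]
  simp [Finsupp.single_left_inj]

/-- The conditions are nested rather than added so that for `s = t`, where the monomial is a square,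
the contribution is counted once. -/
theorem coeff_single_add_single_X_mul [DecidableEq τ] (s t r : τ) (p : MvPolynomial τ k) :
    coeff (Finsupp.single s 1 + Finsupp.single t 1) (X r * p) =
      if r = s then coeff (Finsupp.single t 1) p
      else if r = t then coeff (Finsupp.single s 1) p else 0 := by
  split_ifs with h1 h2
  · subst h1
    rw [coeff_X_mul]
  · subst h2
    rw [add_comm, coeff_X_mul]
  · rw [coeff_X_mul', if_neg]
    rw [Finsupp.mem_support_iff, Finsupp.add_apply, Finsupp.single_eq_of_ne h1,
      Finsupp.single_eq_of_ne h2]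
    simp

end LinearForms

section LinearCycles

variable {k : Type*} [Field k] {n m : ℕ} {Γ : PreAbstractSimplicialComplex (Fin m)} {i : ℕ}

theorem cellSign_eq_C (U : Finset (Fin n ×ₗ Fin m)) (s : Fin n ×ₗ Fin m) :
    cellSign (GenericRing k n m) U s = C (cellSign k U s) := by
  simp [cellSign]

theorem cellSign_ne_zero (U : Finset (Fin n ×ₗ Fin m)) (s : Fin n ×ₗ Fin m) :
    cellSign k U s ≠ 0 :=
  left_ne_zero_of_mul (cellSign_mul_self (A := k) U s ▸ one_ne_zero)

/-- The coefficient of `x_s` in the entry of `y` at the cell `U`. -/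
noncomputable def cellCoeff (y : SparseIndex Γ n i →₀ GenericRing k n m)
    (U : Finset (Fin n ×ₗ Fin m)) (s : Fin n ×ₗ Fin m) : k :=
  coeff (Finsupp.single s 1) (y.mapDomain SparseIndex.cell U)

theorem isCell_of_cellCoeff_ne_zero {y : SparseIndex Γ n i →₀ GenericRing k n m}
    {U : Finset (Fin n ×ₗ Fin m)} {s : Fin n ×ₗ Fin m} (h : cellCoeff y U s ≠ 0) :
    IsCell Γ U ∧ U.card = n + i := by
  by_contra h'
  rw [cellCoeff, mapDomain_cell_eq_zero y h', coeff_zero] at h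
  exact h rfl

theorem sum_cellCoeff_eq_zero {y : SparseIndex Γ n (i + 1) →₀ GenericRing k n m}
    (hy : sparseDifferential k n Γ i y = 0) {U : Finset (Fin n ×ₗ Fin m)} (hU : IsCell Γ U)
    (hc : U.card = n + i) (s t : Fin n ×ₗ Fin m) :
    ∑ r ∈ Uᶜ, cellSign k U r * (if r = s then cellCoeff y (insert r U) t
      else if r = t then cellCoeff y (insert r U) s else 0) = 0 := by
  have h := mapDomain_cell_sparseDifferential y hU hc
  rw [hy, Finsupp.mapDomain_zero, Finsupp.zero_apply] at h
  have h1 := congrArg (coeff (Finsupp.single s 1 + Finsupp.single t 1)) h.symm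
  rw [coeff_sum, coeff_zero] at h1
  refine Eq.trans (Finset.sum_congr rfl fun r _ => ?_) h1
  rw [cellSign_eq_C, mul_assoc, coeff_C_mul, coeff_single_add_single_X_mul]
  rfl

theorem cellCoeff_add_cellCoeff {y : SparseIndex Γ n (i + 1) →₀ GenericRing k n m}
    (hy : sparseDifferential k n Γ i y = 0) {U : Finset (Fin n ×ₗ Fin m)} (hU : IsCell Γ U)
    (hc : U.card = n + i) {s t : Fin n ×ₗ Fin m} (hs : s ∉ U) (ht : t ∉ U) (hne : s ≠ t) :
    cellSign k U s * cellCoeff y (insert s U) t + cellSign k U t * cellCoeff y (insert t U) s =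
      0 := by
  have h := sum_cellCoeff_eq_zero hy hU hc s t
  rw [Finset.sum_eq_add s t hne] at h
  · simpa [hne.symm] using h
  · rintro r _ ⟨h1, h2⟩
    simp [h1, h2]
  · intro h; exact absurd (Finset.mem_compl.mpr hs) h
  · intro h; exact absurd (Finset.mem_compl.mpr ht) h

/-- In the coefficient of `x_s x_t` only the term adding `s` survives: `t` is either `s` itself or
already in `U`, so there is no second way to produce the monomial. -/
theorem cellCoeff_insert_eq_zero {y : SparseIndex Γ n (i + 1) →₀ GenericRing k n m}
    (hy : sparseDifferential k n Γ i y = 0) {U : Finset (Fin n ×ₗ Fin m)} (hU : IsCell Γ U)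
    (hc : U.card = n + i) {s t : Fin n ×ₗ Fin m} (hs : s ∉ U) (ht : t ∈ insert s U) :
    cellCoeff y (insert s U) t = 0 := by
  have h := sum_cellCoeff_eq_zero hy hU hc s t
  rw [Finset.sum_eq_single s] at h
  · simpa [cellSign_ne_zero] using h
  · intro r hr hrs
    have hrt : r ≠ t := by
      rintro rfl
      exact (Finset.mem_insert.mp ht).elim hrs (Finset.mem_compl.mp hr)
    simp [hrs, hrt]
  · intro h; exact absurd (Finset.mem_compl.mpr hs) h

/-- The coefficients of `y` sit where a boundary of a vector of constants can have them. -/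
def IsSupportedOnBoundaries (y : SparseIndex Γ n i →₀ GenericRing k n m) : Prop :=
  ∀ U s, cellCoeff y U s ≠ 0 → s ∉ U ∧ IsCell Γ (insert s U)

/-- Up to sign, the coefficients of `y` at the facets of a cell agree. -/
def IsCompatibleOnCells (y : SparseIndex Γ n i →₀ GenericRing k n m) : Prop :=
  ∀ W, IsCell Γ W → W.card = n + (i + 1) → ∀ s ∈ W, ∀ t ∈ W, IsCell Γ (W.erase s) →
    IsCell Γ (W.erase t) →
    cellSign k W s * cellCoeff y (W.erase s) s = cellSign k W t * cellCoeff y (W.erase t) t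

/-- `U` has more than `n` points, hence two adjacent points `t < t'` in one row. The cycle relations
at `U ∖ t` and `U ∖ t'` show that `U ∪ s` becomes a cell on removing `t` or `t'`, and it does so on
removing `s`. Two of these three points are adjacent in `U ∪ s`. -/
theorem isSupportedOnBoundaries_of_sparseDifferential_eq_zero (hΓ : HasAdjacentProperty n Γ)
    {y : SparseIndex Γ n (i + 1) →₀ GenericRing k n m} (hy : sparseDifferential k n Γ i y = 0) :
    IsSupportedOnBoundaries y := by
  intro U s hUs
  obtain ⟨hU, hc⟩ := isCell_of_cellCoeff_ne_zero hUs
  have key : ∀ t ∈ U, (∀ a, ∃ x ∈ U.erase t, rowOf x = a) → (U.erase t).Nonempty →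
      s ∉ U ∧ IsCell Γ (insert s (U.erase t)) := by
    intro t ht hrow hne
    have hU' : IsCell Γ (U.erase t) := hU.of_subset (Finset.erase_subset _ _) hrow hne
    have hc' : (U.erase t).card = n + i := by
      rw [Finset.card_erase_of_mem ht, hc]
      omega
    have hsU : s ∉ U := by
      intro hsU
      refine hUs ?_
      have h := cellCoeff_insert_eq_zero hy hU' hc' (Finset.notMem_erase t U)
        (t := s) (by rwa [Finset.insert_erase ht])
      rwa [Finset.insert_erase ht] at h
    refine ⟨hsU, ?_⟩
    have h := cellCoeff_add_cellCoeff hy hU' hc' (Finset.notMem_erase t U)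
      (fun h => hsU (Finset.mem_of_mem_erase h)) (t := s) (fun h => hsU (h ▸ ht))
    rw [Finset.insert_erase ht] at h
    -- The relation at `U ∖ t` transfers the nonzero coefficient of `x_s` at `U` to `x_t` at `(U ∖
    -- t) ∪ s`, which must therefore be a cell.
    refine (isCell_of_cellCoeff_ne_zero (y := y) (s := t) fun h0 => ?_).1
    rw [h0, mul_zero, add_zero] at h
    exact mul_ne_zero (cellSign_ne_zero _ _) hUs h
  obtain ⟨t, ht, t', ht', htt, hr, hadj⟩ := exists_adjacent_rowOf_eq (W := U) (by omega)
  obtain ⟨hsU, h1⟩ := key t ht (hU.exists_row_erase ht' htt.ne' hr.symm)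
    ⟨t', Finset.mem_erase.mpr ⟨htt.ne', ht'⟩⟩
  obtain ⟨-, h2⟩ := key t' ht' (hU.exists_row_erase ht htt.ne hr)
    ⟨t, Finset.mem_erase.mpr ⟨htt.ne, ht⟩⟩
  refine ⟨hsU, ?_⟩
  have hst : s ≠ t := fun h => hsU (h ▸ ht)
  have hst' : s ≠ t' := fun h => hsU (h ▸ ht')
  have hmem : ∀ x ∈ U, x ∈ insert s (U.erase t) ∨ x ∈ insert s (U.erase t') := by
    intro x hx
    by_cases hxt : x = t
    · subst hxt
      exact Or.inr (Finset.mem_insert_of_mem (Finset.mem_erase.mpr ⟨htt.ne, hx⟩))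
    · exact Or.inl (Finset.mem_insert_of_mem (Finset.mem_erase.mpr ⟨hxt, hx⟩))
  -- The column condition concerns pairs, and each pair of points of `U ∪ s` lies in `U` or in one
  -- of the two new cells.
  have hW : IsStaircase (insert s U) := by
    refine ⟨fun a => ?_, fun x hx z hz hxz => ?_⟩
    · obtain ⟨x, hx, hxa⟩ := hU.exists_row a
      exact ⟨x, Finset.mem_insert_of_mem hx, hxa⟩
    · rcases Finset.mem_insert.mp hx with rfl | hxU
      · rcases Finset.mem_insert.mp hz with rfl | hz
        · exact absurd hxz (lt_irrefl _)
        · rcases hmem z hz with hz | hz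
          · exact h1.col_lt _ (Finset.mem_insert_self _ _) _ hz hxz
          · exact h2.col_lt _ (Finset.mem_insert_self _ _) _ hz hxz
      · rcases Finset.mem_insert.mp hz with rfl | hz
        · rcases hmem x hxU with hx | hx
          · exact h1.col_lt _ hx _ (Finset.mem_insert_self _ _) hxz
          · exact h2.col_lt _ hx _ (Finset.mem_insert_self _ _) hxz
        · exact hU.col_lt _ hxU _ hz hxz
  have hWc : n < (insert s U).card := by
    rw [Finset.card_insert_of_notMem hsU]
    omega
  have ht_mem : t ∈ insert s U := Finset.mem_insert_of_mem ht
  have h1' : IsCell Γ ((insert s U).erase t) := by rwa [Finset.erase_insert_of_ne hst]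
  have h2' : IsCell Γ ((insert s U).erase t') := by rwa [Finset.erase_insert_of_ne hst']
  -- If `s` separates `t` from `t'`, the adjacent pair to use is `t, s`; otherwise `t, t'` are still
  -- adjacent.
  by_cases hbetween : t < s ∧ s < t'
  · refine hW.isCell_of_adjacent hΓ hWc ht_mem (Finset.mem_insert_self _ _) hbetween.1 ?_ h1'
      (by rwa [Finset.erase_insert hsU])
    intro x hx hlt
    rcases Finset.mem_insert.mp hx with rfl | hx
    · exact lt_irrefl _ hlt.2
    · exact hadj x hx ⟨hlt.1, hlt.2.trans hbetween.2⟩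
  · refine hW.isCell_of_adjacent hΓ hWc ht_mem (Finset.mem_insert_of_mem ht') htt ?_ h1' h2'
    intro x hx hlt
    rcases Finset.mem_insert.mp hx with rfl | hx
    · exact hbetween hlt
    · exact hadj x hx hlt

/-- The cycle relation at `W ∖ {s, t}` compares the facets `W ∖ s` and `W ∖ t` directly whenever
that set meets every row. The remaining pairs are compared through a third facet. -/
theorem isCompatibleOnCells_of_sparseDifferential_eq_zero
    {y : SparseIndex Γ n (i + 1) →₀ GenericRing k n m} (hy : sparseDifferential k n Γ i y = 0) :
    IsCompatibleOnCells y := by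
  intro W hW hc
  have step : ∀ s ∈ W, ∀ t ∈ W, s ≠ t → (∀ a, ∃ x ∈ (W.erase s).erase t, rowOf x = a) →
      cellSign k W s * cellCoeff y (W.erase s) s = cellSign k W t * cellCoeff y (W.erase t) t := by
    intro s hs t ht hne hrow
    set U := (W.erase s).erase t with hUdef
    have htW : t ∈ W.erase s := Finset.mem_erase.mpr ⟨hne.symm, ht⟩
    have hcU : U.card = n + i := by
      rw [hUdef, Finset.card_erase_of_mem htW, Finset.card_erase_of_mem hs, hc]
      omega
    have hsub : U ⊆ W := (Finset.erase_subset _ _).trans (Finset.erase_subset _ _)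
    have hUne : U.Nonempty := by
      obtain ⟨x, hx, -⟩ := hrow (rowOf s)
      exact ⟨x, hx⟩
    have hU : IsCell Γ U := hW.of_subset hsub hrow hUne
    have hsU : s ∉ U := fun h => Finset.notMem_erase s W (Finset.mem_of_mem_erase h)
    have htU : t ∉ U := Finset.notMem_erase t _
    have e1 : insert t U = W.erase s := Finset.insert_erase htW
    have e2 : insert s U = W.erase t := by
      rw [hUdef, Finset.erase_right_comm, Finset.insert_erase (Finset.mem_erase.mpr ⟨hne, hs⟩)]
    have h := cellCoeff_add_cellCoeff hy hU hcU hsU htU hne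
    have hsign := cellSign_mul_cellSign_insert (A := k) hsU htU hne
    rw [e1, e2] at h
    rw [e1, e2, cellSign_erase W s, cellSign_erase W t] at hsign
    have h1 := cellSign_mul_self (A := k) U s
    have h2 := cellSign_mul_self (A := k) U t
    have h3 := cellSign_mul_self (A := k) W s
    have h4 := cellSign_mul_self (A := k) W t
    set a := cellSign k U s
    set b := cellSign k U t
    set c := cellSign k W s
    set d := cellSign k W t
    set p := cellCoeff y (W.erase t) t
    set q := cellCoeff y (W.erase s) s
    have hq : q = -(a * b * p) := by
      linear_combination b * h - q * h2
    rw [hq]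
    linear_combination (-(a * p)) * hsign + d * p * h1
  intro s hs t ht hcs hct
  by_cases hne : s = t
  · rw [hne]
  by_cases hrow : ∀ a, ∃ x ∈ (W.erase s).erase t, rowOf x = a
  · exact step s hs t ht hne hrow
  -- Now `s` and `t` are the only points of a common row. As `W` has at least `n + 2` points, some
  -- other row contains two points `r`, `r'`, and `r` can be paired both with `s` and with `t`.
  have hts : t ∈ W.erase s := Finset.mem_erase.mpr ⟨Ne.symm hne, ht⟩
  have hst : s ∈ W.erase t := Finset.mem_erase.mpr ⟨hne, hs⟩
  have hno : ∀ x ∈ W.erase s, x ≠ t → rowOf x ≠ rowOf t := fun x hx hxt hxr =>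
    hrow (hcs.exists_row_erase hx hxt hxr)
  have hrst : rowOf s = rowOf t := by
    obtain ⟨x, hx, hxt⟩ := hct.exists_row (rowOf t)
    rw [Finset.mem_erase] at hx
    by_cases hxs : x = s
    · rw [← hxs, hxt]
    · exact absurd hxt (hno x (Finset.mem_erase.mpr ⟨hxs, hx.2⟩) hx.1)
  obtain ⟨r, hr, r', hr', hlt, hrr⟩ := exists_lt_rowOf_eq (W := W.erase s)
    (by rw [Finset.card_erase_of_mem hs, hc]; omega)
  have hrt : r ≠ t := by
    rintro rfl
    exact hno r' hr' hlt.ne' hrr.symm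
  have hrt' : r' ≠ t := by
    rintro rfl
    exact hno r hr hlt.ne hrr
  rw [Finset.mem_erase] at hr hr'
  have h1 := step s hs r hr.2 hr.1.symm
    (hcs.exists_row_erase (Finset.mem_erase.mpr hr') hlt.ne' hrr.symm)
  have h2 := step t ht r hr.2 hrt.symm
    (hct.exists_row_erase (Finset.mem_erase.mpr ⟨hrt', hr'.2⟩) hlt.ne' hrr.symm)
  exact h1.trans h2.symm

/-- The coefficient of `x_s` times the monomial of `U` must cancel against another cell, which
arises from `U` by trading some `t` for `s`. Then `s` and `t` share a row and all other rows of `U ∪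
s` have one point, so `s` and `t` are adjacent. -/
theorem isSupportedOnBoundaries_of_sparseAugmentation_eq_zero (hΓ : HasAdjacentProperty n Γ)
    {y : SparseIndex Γ n 0 →₀ GenericRing k n m} (hy : sparseAugmentation k n Γ y = 0) :
    IsSupportedOnBoundaries y := by
  classical
  have := Fintype.ofFinite (SparseIndex Γ n 0)
  intro U s hUs
  obtain ⟨hU, hc⟩ := isCell_of_cellCoeff_ne_zero hUs
  obtain ⟨b, rfl⟩ := SparseIndex.exists_cell_eq hU hc
  rw [cellCoeff, mapDomain_cell] at hUs
  have hsum := coeff_sparseAugmentation (Finsupp.single s 1 + cellExponent b.cell) y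
  rw [hy, coeff_zero, ← Finset.add_sum_erase _ _ (Finset.mem_univ b), if_pos le_add_self,
    add_tsub_cancel_right] at hsum
  -- The term of `b` is the given nonzero coefficient, so the other terms cannot sum to zero.
  have hrest := fun h => hUs ((add_zero _).symm.trans ((congrArg _ h).symm.trans hsum.symm))
  obtain ⟨c, hcb, hcne⟩ := Finset.exists_ne_zero_of_sum_ne_zero hrest
  have hcb := Finset.ne_of_mem_erase hcb
  have hle : cellExponent c.cell ≤ Finsupp.single s 1 + cellExponent b.cell := by
    by_contra h
    simp [h] at hcne
  have hsub := subset_insert_of_cellExponent_le hle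
  have hcb' : c.cell ≠ b.cell := fun h => hcb (SparseIndex.cell_injective h)
  have hcard : c.cell.card = b.cell.card := by rw [c.card_cell, b.card_cell]
  have hs : s ∉ b.cell := fun hs =>
    hcb' (Finset.eq_of_subset_of_card_le (by rwa [Finset.insert_eq_self.mpr hs] at hsub) hcard.ge)
  obtain ⟨t, htb, htc⟩ : ∃ t ∈ b.cell, t ∉ c.cell := by
    by_contra! h
    exact hcb' (Finset.eq_of_subset_of_card_le h hcard.le).symm
  refine ⟨hs, ?_⟩
  set W := insert s b.cell with hWdef
  have hsW : s ∈ W := Finset.mem_insert_self _ _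
  have htW : t ∈ W := Finset.mem_insert_of_mem htb
  have hst : s ≠ t := fun h => hs (h ▸ htb)
  have hWs : W.erase s = b.cell := Finset.erase_insert hs
  have hWc : W.card = n + 1 := by rw [hWdef, Finset.card_insert_of_notMem hs, b.card_cell]
  have hWt : W.erase t = c.cell := by
    refine (Finset.eq_of_subset_of_card_le (fun x hx => Finset.mem_erase.mpr
      ⟨fun h : x = t => htc (h ▸ hx), hsub hx⟩) ?_).symm
    rw [Finset.card_erase_of_mem htW, hWc, c.card_cell]
    rfl
  have hinj := rowOf_injOn_of_card b.isStaircase_cell.exists_row b.card_cell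
  have hrow : rowOf s = rowOf t := by
    obtain ⟨x, hx, hxt⟩ := c.isStaircase_cell.exists_row (rowOf t)
    rcases Finset.mem_insert.mp (hsub hx) with rfl | hxb
    · exact hxt
    · exact absurd (hinj hxb htb hxt ▸ hx) htc
  have hW : IsStaircase W := by
    refine ⟨fun a => ?_, fun x hx z hz hxz => ?_⟩
    · obtain ⟨x, hx, hxa⟩ := b.isStaircase_cell.exists_row a
      exact ⟨x, Finset.mem_insert_of_mem hx, hxa⟩
    · by_cases h : x = s ∨ z = s
      · have hx' : x ∈ c.cell := by
          rw [← hWt, Finset.mem_erase]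
          refine ⟨?_, hx⟩
          rintro rfl
          rcases h with h | h
          · exact hst h.symm
          · rw [h, hrow] at hxz
            exact lt_irrefl _ hxz
        have hz' : z ∈ c.cell := by
          rw [← hWt, Finset.mem_erase]
          refine ⟨?_, hz⟩
          rintro rfl
          rcases h with h | h
          · rw [h, hrow] at hxz
            exact lt_irrefl _ hxz
          · exact hst h.symm
        exact c.isStaircase_cell.col_lt x hx' z hz' hxz
      · push Not at h
        exact b.isStaircase_cell.col_lt x ((Finset.mem_insert.mp hx).resolve_left h.1) z
          ((Finset.mem_insert.mp hz).resolve_left h.2) hxz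
  have hno : ∀ x ∈ W, x ≠ s → x ≠ t → rowOf x ≠ rowOf t := fun x hx hxs hxt h =>
    hxt (hinj ((Finset.mem_insert.mp hx).resolve_left hxs) htb h)
  have hcs : IsCell Γ (W.erase s) := hWs ▸ b.isCell_cell
  have hct : IsCell Γ (W.erase t) := hWt ▸ c.isCell_cell
  rcases lt_or_gt_of_ne hst with h | h
  · exact hW.isCell_of_adjacent hΓ (by omega) hsW htW h (fun x hx hlt =>
      hno x hx hlt.1.ne' hlt.2.ne (rowOf_eq_of_lt_of_lt hrow hlt.1 hlt.2)) hcs hct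
  · exact hW.isCell_of_adjacent hΓ (by omega) htW hsW h (fun x hx hlt =>
      hno x hx hlt.2.ne hlt.1.ne'
        ((rowOf_eq_of_lt_of_lt hrow.symm hlt.1 hlt.2).trans hrow)) hct hcs

/-- Only the two removable points of `W` contribute to the coefficient of the monomial of `W`, so
their coefficients sum to zero. The points are adjacent, so their signs are opposite as well. -/
theorem isCompatibleOnCells_of_sparseAugmentation_eq_zero
    {y : SparseIndex Γ n 0 →₀ GenericRing k n m} (hy : sparseAugmentation k n Γ y = 0) :
    IsCompatibleOnCells y := by
  classical
  have := Fintype.ofFinite (SparseIndex Γ n 0)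
  intro W hW hc
  obtain ⟨s, hs, t, ht, hst, hadj, hrs, hrt, honly⟩ := hW.exists_removable hc
  have hcell : ∀ r ∈ W, (∀ a, ∃ x ∈ W.erase r, rowOf x = a) → (W.erase r).Nonempty →
      ∃ b : SparseIndex Γ n 0, b.cell = W.erase r := fun r hr hrow hne =>
    SparseIndex.exists_cell_eq (hW.of_subset (Finset.erase_subset _ _) hrow hne)
      (by rw [Finset.card_erase_of_mem hr, hc]; rfl)
  obtain ⟨bs, hbs⟩ := hcell s hs hrs ⟨t, Finset.mem_erase.mpr ⟨hst.ne', ht⟩⟩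
  obtain ⟨bt, hbt⟩ := hcell t ht hrt ⟨s, Finset.mem_erase.mpr ⟨hst.ne, hs⟩⟩
  have hne : bs ≠ bt := by
    rintro rfl
    have : s ∈ bs.cell := hbt ▸ Finset.mem_erase.mpr ⟨hst.ne, hs⟩
    rw [hbs] at this
    exact Finset.notMem_erase _ _ this
  have hterm : ∀ r ∈ W, ∀ b : SparseIndex Γ n 0, b.cell = W.erase r →
      (if cellExponent b.cell ≤ cellExponent W then
        coeff (cellExponent W - cellExponent b.cell) (y b) else 0) =
        cellCoeff y (W.erase r) r := by
    intro r hr b hb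
    rw [cellCoeff, ← hb, mapDomain_cell, cellExponent_eq_add_erase hr, ← hb, if_pos le_add_self,
      add_tsub_cancel_right]
  have hsum : cellCoeff y (W.erase s) s + cellCoeff y (W.erase t) t = 0 := by
    have h := coeff_sparseAugmentation (cellExponent W) y
    rw [hy, coeff_zero, Fintype.sum_eq_add bs bt hne] at h
    · rw [← hterm s hs bs hbs, ← hterm t ht bt hbt]
      exact h.symm
    · rintro b ⟨h1, h2⟩
      rw [if_neg]
      intro hle
      have hsub := subset_of_cellExponent_le hle
      obtain ⟨r, hrW, hrb⟩ : ∃ r ∈ W, r ∉ b.cell := by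
        by_contra! h
        have := Finset.card_le_card h
        rw [b.card_cell, hc] at this
        omega
      have hb : b.cell = W.erase r := by
        refine Finset.eq_of_subset_of_card_le (fun x hx => Finset.mem_erase.mpr
          ⟨fun h => hrb (h ▸ hx), hsub hx⟩) ?_
        rw [Finset.card_erase_of_mem hrW, hc, b.card_cell]
        rfl
      rcases honly r hrW (hb ▸ b.isStaircase_cell.exists_row) with rfl | rfl
      · exact h1 (SparseIndex.cell_injective (hb.trans hbs.symm))
      · exact h2 (SparseIndex.cell_injective (hb.trans hbt.symm))
  have hmain : cellSign k W s * cellCoeff y (W.erase s) s =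
      cellSign k W t * cellCoeff y (W.erase t) t := by
    rw [cellSign_of_adjacent hs hst hadj]
    linear_combination cellSign k W s * hsum
  intro p hp q hq hcp hcq
  rcases honly p hp hcp.exists_row with rfl | rfl <;>
    rcases honly q hq hcq.exists_row with rfl | rfl
  exacts [rfl, hmain, hmain.symm, rfl]

theorem SparseIndex.exists_removable (b : SparseIndex Γ n (i + 1)) :
    ∃ s ∈ b.cell, IsCell Γ (b.cell.erase s) := by
  obtain ⟨s, hs, t, ht, hlt, hr⟩ := exists_lt_rowOf_eq (W := b.cell) (by rw [b.card_cell]; omega)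
  exact ⟨s, hs, b.isCell_cell.of_subset (Finset.erase_subset _ _)
    (b.isStaircase_cell.exists_row_erase ht hlt.ne' hr.symm)
    ⟨t, Finset.mem_erase.mpr ⟨hlt.ne', ht⟩⟩⟩

theorem mapDomain_constVec (x : SparseIndex Γ n i →₀ k) (U : Finset (Fin n ×ₗ Fin m)) :
    (constVec k (Fin n ×ₗ Fin m) _ x).mapDomain SparseIndex.cell U =
      C (x.mapDomain SparseIndex.cell U) := by
  by_cases hU : IsCell Γ U ∧ U.card = n + i
  · obtain ⟨b, rfl⟩ := SparseIndex.exists_cell_eq hU.1 hU.2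
    rw [mapDomain_cell, mapDomain_cell, constVec_apply]
  · rw [mapDomain_cell_eq_zero _ hU, mapDomain_cell_eq_zero _ hU, map_zero]

theorem isHomogeneous_sparseDifferential_constVec (x : SparseIndex Γ n (i + 1) →₀ k)
    (b : SparseIndex Γ n i) :
    (sparseDifferential k n Γ i (constVec k _ _ x) b).IsHomogeneous 1 := by
  rw [sparseDifferential_apply]
  refine IsHomogeneous.sum _ _ _ fun s _ => ?_
  rw [mapDomain_constVec, cellSign_eq_C]
  exact ((isHomogeneous_C _ _).mul (isHomogeneous_X k s)).mul (isHomogeneous_C _ _)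

theorem coeff_sparseDifferential_constVec (x : SparseIndex Γ n (i + 1) →₀ k)
    (b : SparseIndex Γ n i) (s : Fin n ×ₗ Fin m) :
    coeff (Finsupp.single s 1) (sparseDifferential k n Γ i (constVec k _ _ x) b) =
      if s ∈ b.cell then 0 else
        cellSign k b.cell s * x.mapDomain SparseIndex.cell (insert s b.cell) := by
  rw [sparseDifferential_apply, coeff_sum]
  simp only [mapDomain_constVec, cellSign_eq_C, mul_assoc, coeff_C_mul, coeff_single_X_mul_C]
  simp only [mul_ite, mul_zero, Finset.sum_ite_eq', Finset.mem_compl]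
  rw [ite_not]

/-- Every cell with more than `n` points has a facet that is a cell, and the coefficient of the
removed variable there recovers the entry of `x` up to sign. -/
theorem sparseDifferential_constVec_injective (x : SparseIndex Γ n (i + 1) →₀ k)
    (hx : sparseDifferential k n Γ i (constVec k _ _ x) = 0) : x = 0 := by
  ext b
  obtain ⟨s, hs, hcell⟩ := b.exists_removable
  obtain ⟨c, hc⟩ := SparseIndex.exists_cell_eq (i := i) hcell
    (by rw [Finset.card_erase_of_mem hs, b.card_cell]; omega)
  have h := coeff_sparseDifferential_constVec x c s
  rw [hx, Finsupp.zero_apply, coeff_zero, hc, if_neg (Finset.notMem_erase _ _),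
    Finset.insert_erase hs, mapDomain_cell] at h
  exact (mul_eq_zero.mp h.symm).resolve_left (cellSign_ne_zero _ _)

/-- The entry of `x` at a cell is read off at an arbitrarily chosen facet. Compatibility makes the
choice irrelevant, and the support condition excludes coefficients of `y` that no cell accounts for.
-/
theorem exists_sparseDifferential_constVec_eq {y : SparseIndex Γ n i →₀ GenericRing k n m}
    (hlin : ∀ b, (y b).IsHomogeneous 1) (hsupp : IsSupportedOnBoundaries y)
    (hcomp : IsCompatibleOnCells y) :
    ∃ x, sparseDifferential k n Γ i (constVec k _ _ x) = y := by
  choose r hr hrcell using fun b : SparseIndex Γ n (i + 1) => b.exists_removable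
  let x : SparseIndex Γ n (i + 1) →₀ k := Finsupp.equivFunOnFinite.symm fun b =>
    cellSign k b.cell (r b) * cellCoeff y (b.cell.erase (r b)) (r b)
  refine ⟨x, Finsupp.ext fun b => ?_⟩
  refine eq_of_coeff_single_eq (isHomogeneous_sparseDifferential_constVec x b) (hlin b)
    fun s => ?_
  rw [coeff_sparseDifferential_constVec, ← mapDomain_cell y b]
  change _ = cellCoeff y b.cell s
  by_cases h0 : cellCoeff y b.cell s = 0
  · rw [h0]
    split_ifs with hs
    · rfl
    · by_cases hcell : IsCell Γ (insert s b.cell)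
      · obtain ⟨c, hc⟩ := SparseIndex.exists_cell_eq (i := i + 1) hcell
          (by rw [Finset.card_insert_of_notMem hs, b.card_cell]; rfl)
        have hbs : c.cell.erase s = b.cell := by rw [hc, Finset.erase_insert hs]
        have hcs : s ∈ c.cell := hc ▸ Finset.mem_insert_self _ _
        have h1 := hcomp c.cell c.isCell_cell c.card_cell (r c) (hr c) s hcs (hrcell c)
          (hbs ▸ b.isCell_cell)
        rw [hbs, h0, mul_zero] at h1
        have hxc : x c = 0 := h1
        rw [← hc, mapDomain_cell, hxc, mul_zero]
      · rw [mapDomain_cell_eq_zero _ fun h => hcell h.1, mul_zero]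
  · obtain ⟨hs, hcell⟩ := hsupp b.cell s h0
    obtain ⟨c, hc⟩ := SparseIndex.exists_cell_eq (i := i + 1) hcell
      (by rw [Finset.card_insert_of_notMem hs, b.card_cell]; rfl)
    have hbs : c.cell.erase s = b.cell := by rw [hc, Finset.erase_insert hs]
    have hcs : s ∈ c.cell := hc ▸ Finset.mem_insert_self _ _
    have h1 := hcomp c.cell c.isCell_cell c.card_cell (r c) (hr c) s hcs (hrcell c)
      (hbs ▸ b.isCell_cell)
    have hxc : x c = cellSign k c.cell s * cellCoeff y (c.cell.erase s) s := h1
    rw [if_neg hs, ← hc, mapDomain_cell, hxc, ← mul_assoc, ← hbs, cellSign_erase,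
      cellSign_mul_self, one_mul]

theorem isAugmentedLinearStrand_sparseENTail (hΓ : HasAdjacentProperty n Γ) :
    (sparseENTail k n Γ).IsAugmentedLinearStrand (sparseAugmentation k n Γ) where
  ε_injective := sparseAugmentation_constVec_injective
  d_injective _ := sparseDifferential_constVec_injective
  linear _ := isHomogeneous_sparseDifferential_constVec
  ε_comp := sparseAugmentation_sparseDifferential
  d_comp _ := sparseDifferential_sparseDifferential
  exact_zero _ hlin hy := exists_sparseDifferential_constVec_eq hlin
    (isSupportedOnBoundaries_of_sparseAugmentation_eq_zero hΓ hy)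
    (isCompatibleOnCells_of_sparseAugmentation_eq_zero hy)
  exact_succ _ _ hlin hy := exists_sparseDifferential_constVec_eq hlin
    (isSupportedOnBoundaries_of_sparseDifferential_eq_zero hΓ hy)
    (isCompatibleOnCells_of_sparseDifferential_eq_zero hy)

end LinearCycles

/-! ### Clique complexes -/

section Clique

variable {n m : ℕ} {Δ : PreAbstractSimplicialComplex (Fin m)}

/-- Only subsets of `σ` with at most `n` elements have to be tested, and those missing `u` or `v`
are covered by the two given faces. One containing both is enlarged inside `σ` to `n + 1` elements,
where `u` and `v` stay adjacent because nothing of `σ` lies between them. -/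
theorem hasAdjacentProperty_cliqueComplex
    (h : ∀ σ : Finset (Fin m), σ.card = n + 1 → ¬ IsNonface (cliqueComplex Δ n) 1 σ) :
    HasAdjacentProperty n (cliqueComplex Δ n) := by
  intro σ hσ u hu v hv huv hadj hσu hσv
  refine ⟨⟨u, hu⟩, fun ρ hρ hne hcard => ?_⟩
  by_cases huρ : u ∈ ρ
  swap
  · exact hσu.2 ρ (Finset.subset_erase.mpr ⟨hρ, huρ⟩) hne hcard
  by_cases hvρ : v ∈ ρ
  swap
  · exact hσv.2 ρ (Finset.subset_erase.mpr ⟨hρ, hvρ⟩) hne hcard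
  obtain ⟨υ, hρυ, hυσ, hυ⟩ := Finset.exists_subsuperset_card_eq hρ
    (hcard.trans (Nat.le_succ n)) (Nat.succ_le_of_lt hσ)
  suffices hmem : υ ∈ cliqueComplex Δ n from hmem.2 ρ hρυ hne hcard
  by_contra hmem
  refine h υ hυ ⟨hmem, ?_⟩
  have hυu : υ.erase u ∈ cliqueComplex Δ n :=
    ((cliqueComplex Δ n).isRelLowerSet_faces hσu).2 (Finset.erase_subset_erase _ hυσ)
      ⟨v, Finset.mem_erase.mpr ⟨huv.ne', hρυ hvρ⟩⟩
  have hυv : υ.erase v ∈ cliqueComplex Δ n :=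
    ((cliqueComplex Δ n).isRelLowerSet_faces hσv).2 (Finset.erase_subset_erase _ hυσ)
      ⟨u, Finset.mem_erase.mpr ⟨huv.ne, hρυ huρ⟩⟩
  have hrange : ∀ x ∈ υ, ∃ p, υ.orderEmbOfFin rfl p = x := fun x hx => by
    rwa [← Finset.mem_coe, ← Finset.range_orderEmbOfFin υ rfl] at hx
  obtain ⟨p, hp⟩ := hrange u (hρυ huρ)
  obtain ⟨q, hq⟩ := hrange v (hρυ hvρ)
  have hpq : p < q := (υ.orderEmbOfFin rfl).lt_iff_lt.mp (by rwa [hp, hq])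
  have hpq' : (p : ℕ) < q := hpq
  have hq1 : (q : ℕ) = p + 1 := by
    by_contra hne'
    have hlt : (p : ℕ) + 1 < υ.card := by have := q.2; omega
    refine hadj (υ.orderEmbOfFin rfl ⟨p + 1, hlt⟩)
      (hυσ (Finset.orderEmbOfFin_mem _ _ _)) ⟨?_, ?_⟩
    · rw [← hp]
      exact (υ.orderEmbOfFin rfl).strictMono (Fin.lt_def.mpr (Nat.lt_succ_self _))
    · rw [← hq]
      exact (υ.orderEmbOfFin rfl).strictMono (Fin.lt_def.mpr (by simp only; omega))
  refine ⟨p, by have := q.2; omega, fun l hl => ?_⟩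
  rcases Nat.le_one_iff_eq_zero_or_eq_one.mp hl with rfl | rfl
  · exact hp.symm ▸ hυu
  · have : (⟨p + 1, by have := q.2; omega⟩ : Fin υ.card) = q := Fin.ext hq1.symm
    rw [this, hq]
    exact hυv

/-- A face with `n` elements lies in a facet, which by purity has `n` elements too. Hence the minors
generating `J_Δ` are indexed by the same sets as the basis of `C^<_1`. -/
theorem maximal_iff_mem_cliqueComplex (hpure : IsPureOfCard Δ n) {σ : Finset (Fin m)}
    (hσ : σ.card = n) : Maximal (· ∈ Δ) σ ↔ σ ∈ cliqueComplex Δ n := by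
  constructor
  · intro h
    have h1 := Δ.isRelLowerSet_faces h.prop
    exact ⟨h1.1, fun ρ hρ hne _ => h1.2 hρ hne⟩
  · intro h
    have hmem : σ ∈ Δ := h.2 σ subset_rfl h.1 hσ.le
    obtain ⟨ρ, hle, hρ⟩ := (Set.toFinite {ρ | ρ ∈ Δ}).exists_le_maximal hmem
    have hρ' : Maximal (· ∈ Δ) ρ := hρ
    have : σ = ρ := Finset.eq_of_subset_of_card_le hle (by rw [hpure ρ hρ', hσ])
    rwa [this]

theorem exists_sparseAugmentation_constVec_eq_iff {k : Type*} [Field k]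
    (hpure : IsPureOfCard Δ n) (p : GenericRing k n m) :
    (∃ x, sparseAugmentation k n (cliqueComplex Δ n) (constVec k _ _ x) = p) ↔
      p ∈ lexInitialIdeal (determinantalFacetIdeal k n Δ) ∧ p.IsHomogeneous n := by
  have h1 : ∀ x, sparseAugmentation k n (cliqueComplex Δ n) (constVec k _ _ x) =
      Finsupp.linearCombination k (fun b : SparseIndex (cliqueComplex Δ n) n 0 =>
        MonomialOrder.lex.leadingTerm (maximalMinor (n := n) k b.σ b.card_eq)) x := by
    intro x
    induction x using Finsupp.induction_linear with
    | zero => simp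
    | add x y hx hy => simp only [map_add, hx, hy]
    | single b r =>
      rw [constVec_single, sparseAugmentation, Finsupp.linearCombination_single,
        Finsupp.linearCombination_single, smul_eq_mul, smul_eq_C_mul]
  rw [mem_lexInitialIdeal_and_isHomogeneous_iff]
  simp only [h1]
  rw [← LinearMap.mem_range, Finsupp.range_linearCombination]
  refine iff_of_eq (congrArg (fun S => p ∈ Submodule.span k S) (Set.ext fun q => ?_))
  constructor
  · rintro ⟨b, rfl⟩
    exact ⟨b.σ, b.card_eq, (maximal_iff_mem_cliqueComplex hpure b.card_eq).mpr b.mem, rfl⟩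
  · rintro ⟨σ, h, hσ, rfl⟩
    exact ⟨⟨0, σ, (maximal_iff_mem_cliqueComplex hpure h).mp hσ, h, by simp⟩, rfl⟩

end Clique

theorem mainTheorem1 {k : Type*} [Field k] {n m : ℕ} (hn : 1 ≤ n) (hnm : n ≤ m)
    (Δ : PreAbstractSimplicialComplex (Fin m)) (hpure : IsPureOfCard Δ n)
    (hnonface : ∀ σ : Finset (Fin m), σ.card = n + 1 → ¬ IsNonface (cliqueComplex Δ n) 1 σ)
    (F : MinimalGradedFreeResolution (lexInitialIdeal (determinantalFacetIdeal k n Δ))) :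
    (sparseEagonNorthcott k n (cliqueComplex Δ n)).IsComplex ∧
      Nonempty ((F.augmentedLinearStrand n).Iso
        (sparseEagonNorthcott k n (cliqueComplex Δ n))) := by
  have hΓ := hasAdjacentProperty_cliqueComplex hnonface
  have hS := isAugmentedLinearStrand_sparseENTail (k := k) hΓ
  have hF := F.isAugmentedLinearStrand_linearStrand le_of_mem_lexInitialIdeal
  refine ⟨fun i => LinearMap.ext fun x =>
    (hS.augment (sparseAugmentation_homogeneous k n _)).comp i x, ?_⟩
  -- Membership in the strand is the equation `deg = n + i`, and `n + i` is the degree of every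
  -- basis element on the other side.
  refine hF.nonempty_iso hS _ _ (fun i b c => b.2) fun p => ?_
  exact (F.exists_strandAugmentation_eq_iff le_of_mem_lexInitialIdeal p).trans
    (exists_sparseAugmentation_constVec_eq_iff hpure p).symm
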